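/- Robust sparse mean estimation, information-theoretically. A vector is $k$-sparse if it has at most $k$ nonzero coordinates. An $\varepsilon$-corrupted set of $n$ samples from $D$ is produced by drawing $n$ independent samples from $D$, after which an adversary who sees them changes at most $\varepsilon n$ of them arbitrarily and returns the resulting points in any order. An estimator is a function $\widehat\mu$ of the $n$ given points in $\mathbb R^d$ (it may depend on $d,k,n,\varepsilon,\delta$, but not on $\mu$). We say that it has error at most $r$ with probability at least $1-\delta$ if for every $k$-sparse $\mu\in\mathbb R^d$, with probability at least $1-\delta$ over $n$ independent samples from $\mathcal N(\mu,I)$, every admissible choice of the adversary leads to $\|\mu-\widehat\mu\|_2\le r$. (a) Upper bound. For every $\varepsilon_0\in(0,1/2)$ there is a constant $C>0$, depending only on $\varepsilon_0$, such that for all $d,k,n$, all $0<\varepsilon\le\varepsilon_0$ and $0<\delta<1$ with $$n\;\ge\; C\,\frac{k\log(d/\varepsilon)+\log(1/\delta)}{\varepsilon^2}$$ (for $d=0$ the logarithm $\log(d/\varepsilon)$ is read as $0$) there is a measurable (not necessarily efficiently computable) estimator which, from $\varepsilon$-corrupted samples, has error at most $C\varepsilon$ with probability at least $1-\delta$. (b)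 The error is optimal up to a constant. There is a universal constant $c>0$ such that for all $d,k\ge1$, all $n$ and all $\varepsilon>0$, no estimator from $\varepsilon$-corrupted samples has error at most $c\varepsilon$ with probability greater than $1/2$. (c) The sample size is optimal up to logarithmic factors, even without corruption. For every $K>0$ there is a constant $c>0$, depending only on $K$, such that for all $1\le k\le d$, $n$, $\varepsilon>0$ and $0<\delta\le1/2$: if some estimator from $n$ uncorrupted samples (given in any order) has error at most $K\varepsilon$ with probability at least $1-\delta$, then $$n\;\ge\; c\,\frac{k+\log(1/\delta)}{\varepsilon^2}.$$ -/

import Mathlib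

open MeasureTheory ProbabilityTheory

namespace RobustSparse

/-- A vector of `ℝ^d` is `k`-sparse if at most `k` of its coordinates are nonzero. -/
def IsSparse {d : ℕ} (k : ℕ) (v : EuclideanSpace ℝ (Fin d)) : Prop :=
  {i : Fin d | v i ≠ 0}.ncard ≤ k

/-- `Y` is obtained from the sample `X` of size `n` by changing at most `ε * n` of the points
arbitrarily and returning the resulting points in an arbitrary order. -/
def IsCorruption {d n : ℕ} (ε : ℝ) (X Y : Fin n → EuclideanSpace ℝ (Fin d)) : Prop :=
  ∃ σ : Equiv.Perm (Fin n), ({i : Fin n | Y i ≠ X (σ i)}.ncard : ℝ) ≤ ε * n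

/-- The law of `n` independent samples from the Gaussian `N(μ, I)` on `ℝ^d`. -/
noncomputable def sampleLaw {d : ℕ} (n : ℕ) (μ : EuclideanSpace ℝ (Fin d)) :
    Measure (Fin n → EuclideanSpace ℝ (Fin d)) :=
  Measure.pi fun _ => multivariateGaussian μ (1 : Matrix (Fin d) (Fin d) ℝ)

/-- The estimator `T` recovers every `k`-sparse mean up to `ℓ₂` error `r`, with probability at
least `1 - δ` over the drawn samples, from an `ε`-corrupted set of `n` samples: outside an event
of probability at most `δ`, whatever corruption the adversary chooses after seeing the samples,
the error is at most `r`. (The measure of a set in Mathlib is its outer measure if it is not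
measurable, so no measurability of the bad event is presupposed.) -/
def Recovers {d n : ℕ} (k : ℕ) (ε r δ : ℝ)
    (T : (Fin n → EuclideanSpace ℝ (Fin d)) → EuclideanSpace ℝ (Fin d)) : Prop :=
  ∀ μ : EuclideanSpace ℝ (Fin d), IsSparse k μ →
    sampleLaw n μ {X | ∃ Y, IsCorruption ε X Y ∧ r < ‖μ - T Y‖} ≤ ENNReal.ofReal δ

end RobustSparse

/-!
The three parts rest on different ideas.

*Upper bound.* The estimator returns a sparse point of large approximate Tukey depth, where depth
is tested only in finitely many directions (`testDirection`). A point is central (`IsCentral`) if in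
each direction fewer than half of the points lie more than a threshold above it. By Hoeffding's
inequality and a union bound over the directions, the true mean is central with threshold
proportional to `ε`, whatever the adversary does (`sampleLaw_not_isCentral_le`). That this works for
all `ε ≤ ε₀ < 1 / 2` comes from the concavity of the mass of `(0, t]` under `N(0, 1)`
(`exists_gaussianReal_Ioi_le`). Two central sparse points are close: in a direction along their
difference, half of the sample would otherwise lie above one and half below the other
(`IsCentral.norm_sub_le`). The directions are sparse vectors with integer coordinates of size
at most `2 d`; rounding shows that they suffice, and their number is at most `(d / ε) ^ (6 k)`. A measurable
choice is the first central point in a dense sequence of sparse vectors.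

*Optimality of the error.* By reflection, `N(0, 1)` and `N(±ε/8, 1)` are coupled so that they differ
with probability at most `ε / 4` (`couplingLaw_ne_le`). Applied to one coordinate of every sample
point, Markov's inequality lets the adversary replace, with probability at least `3 / 4`, the sample
for either mean `±ε/8` by the sample for the mean `0`. The estimate from the latter would have to be
close to all three means, on events whose probabilities add up to more than `1`. Three means are
needed because two would allow success probabilities slightly above `1 / 2`.

*Optimality of the sample size.* The density of `n` samples for the mean `μ` relative to the mean
`0` has second moment `exp (n ‖μ‖²)`, so by Cauchy-Schwarz an event of probability `1 / 2` under `μ` has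
probability at least `exp (-n ‖μ‖²) / 4` under `0` (`sq_sampleLaw_le`). Applied to the disjoint
success events of `8 ^ k` separated means at distance `O(ε)` from `0`, this gives `n ε² ≳ k`;
applied to two means, it gives `n ε² ≳ log (1 / δ)`.

Estimators in the lower bounds need not be measurable: `Recovers.exists_measurableSet` provides
measurable events on which they succeed.
-/

namespace RobustSparse
open scoped ENNReal RealInnerProductSpace

/-! ### Samples as products of one-dimensional Gaussians -/

lemma map_pi_gaussianReal_eq_multivariateGaussian {d : ℕ} (μ : EuclideanSpace ℝ (Fin d)) :
    (Measure.pi fun i => gaussianReal (μ i) 1).map (WithLp.toLp 2) =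
      multivariateGaussian μ (1 : Matrix (Fin d) (Fin d) ℝ) := by
  apply Measure.ext_of_charFun (E := EuclideanSpace ℝ (Fin d))
  ext t
  rw [charFun_pi, charFun_multivariateGaussian Matrix.PosSemidef.one]
  simp_rw [charFun_gaussianReal, ← Complex.exp_sum]
  congr 1
  simp only [Matrix.one_mulVec, dotProduct, PiLp.inner_apply, NNReal.coe_one, Complex.ofReal_one,
    one_mul, Finset.sum_sub_distrib, Finset.sum_div, Complex.ofReal_sum, Finset.sum_mul]
  congr 1
  · refine Finset.sum_congr rfl fun i _ => ?_
    simp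
    ring
  · refine Finset.sum_congr rfl fun i _ => ?_
    push_cast
    ring

/-- The law of a sample, seen as a matrix with independent Gaussian entries. -/
noncomputable def entryLaw {d : ℕ} (n : ℕ) (μ : EuclideanSpace ℝ (Fin d)) :
    Measure (Fin n → Fin d → ℝ) :=
  Measure.pi fun _ => Measure.pi fun i => gaussianReal (μ i) 1

instance {d n : ℕ} (μ : EuclideanSpace ℝ (Fin d)) : IsProbabilityMeasure (entryLaw n μ) := by
  unfold entryLaw; infer_instance

instance {d n : ℕ} (μ : EuclideanSpace ℝ (Fin d)) : IsProbabilityMeasure (sampleLaw n μ) := by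
  unfold sampleLaw; infer_instance

lemma measurable_toLp_comp {d n : ℕ} : Measurable
    fun (X : Fin n → Fin d → ℝ) j => (WithLp.toLp 2 (X j) : EuclideanSpace ℝ (Fin d)) := by
  fun_prop

lemma sampleLaw_eq_map {d n : ℕ} (μ : EuclideanSpace ℝ (Fin d)) :
    sampleLaw n μ = (entryLaw n μ).map fun X j => WithLp.toLp 2 (X j) := by
  rw [entryLaw, Measure.pi_map_pi (f := fun _ => WithLp.toLp 2)
    (fun i => (WithLp.measurable_toLp 2 _).aemeasurable)]
  simp_rw [map_pi_gaussianReal_eq_multivariateGaussian]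
  rfl

/-! ### Second moments of likelihood ratios -/

/-- `Q` has a density with respect to `P` whose second moment under `P` is `c`, that is, the
chi-square divergence of `Q` from `P` is `c - 1`. -/
def HasDensitySecondMoment {α : Type*} [MeasurableSpace α] (P Q : Measure α) (c : ℝ≥0∞) : Prop :=
  ∃ f : α → ℝ≥0∞, Measurable f ∧ Q = P.withDensity f ∧ ∫⁻ x, f x ^ 2 ∂P = c

lemma lintegral_pi_prod {ι : Type*} [Fintype ι] {α : ι → Type*} [∀ i, MeasurableSpace (α i)]
    (P : ∀ i, Measure (α i)) [∀ i, IsProbabilityMeasure (P i)] (f : ∀ i, α i → ℝ≥0∞)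
    (hf : ∀ i, Measurable (f i)) :
    ∫⁻ x, ∏ i, f i (x i) ∂(Measure.pi P) = ∏ i, ∫⁻ y, f i y ∂(P i) := by
  have h := lintegral_prod_eq_prod_lintegral_of_indepFun (μ := Measure.pi P) Finset.univ
    (fun i x => f i (x i)) (iIndepFun_pi fun i => (hf i).aemeasurable)
    (fun i => (hf i).comp (measurable_pi_apply i))
  rw [h]
  refine Finset.prod_congr rfl fun i _ => ?_
  exact (measurePreserving_eval P i).lintegral_comp (hf i)

lemma HasDensitySecondMoment.pi {ι : Type*} [Fintype ι] {α : ι → Type*}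
    [∀ i, MeasurableSpace (α i)] {P Q : ∀ i, Measure (α i)} [∀ i, IsProbabilityMeasure (P i)]
    [∀ i, IsProbabilityMeasure (Q i)] {c : ι → ℝ≥0∞}
    (h : ∀ i, HasDensitySecondMoment (P i) (Q i) (c i)) :
    HasDensitySecondMoment (Measure.pi P) (Measure.pi Q) (∏ i, c i) := by
  choose f hf hQ hc using h
  have hmeas : Measurable fun x : ∀ i, α i => ∏ i, f i (x i) :=
    Finset.measurable_prod _ fun i _ => (hf i).comp (measurable_pi_apply i)
  refine ⟨fun x => ∏ i, f i (x i), hmeas, ?_, ?_⟩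
  · refine Measure.pi_eq fun s hs => ?_
    rw [withDensity_apply _ (MeasurableSet.univ_pi hs), ← lintegral_indicator
      (MeasurableSet.univ_pi hs)]
    have : ∀ x : ∀ i, α i, (Set.univ.pi s).indicator (fun x => ∏ i, f i (x i)) x =
        ∏ i, (s i).indicator (f i) (x i) := by
      intro x
      by_cases hx : x ∈ Set.univ.pi s
      · rw [Set.indicator_of_mem hx]
        exact Finset.prod_congr rfl fun i _ => (Set.indicator_of_mem (hx i trivial) _).symm
      · rw [Set.indicator_of_notMem hx]
        simp only [Set.mem_univ_pi, not_forall] at hx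
        obtain ⟨i, hi⟩ := hx
        exact (Finset.prod_eq_zero (Finset.mem_univ i) (Set.indicator_of_notMem hi _)).symm
    simp_rw [this]
    rw [lintegral_pi_prod P _ fun i => (hf i).indicator (hs i)]
    refine Finset.prod_congr rfl fun i _ => ?_
    rw [lintegral_indicator (hs i), hQ i, withDensity_apply _ (hs i)]
  · simp_rw [← Finset.prod_pow]
    rw [lintegral_pi_prod P (fun i y => f i y ^ 2) fun i => (hf i).pow_const 2]
    exact Finset.prod_congr rfl fun i _ => hc i

/-- A change of measure costs at most the second moment of the density: Cauchy-Schwarz. -/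
lemma HasDensitySecondMoment.sq_measure_le {α : Type*} [MeasurableSpace α] {P Q : Measure α}
    {c : ℝ≥0∞} (h : HasDensitySecondMoment P Q c) {A : Set α} (hA : MeasurableSet A) :
    Q A ^ 2 ≤ c * P A := by
  obtain ⟨f, hf, rfl, rfl⟩ := h
  rw [withDensity_apply _ hA, ← lintegral_indicator hA]
  have h2 := ENNReal.lintegral_mul_le_Lp_mul_Lq P (p := 2) (q := 2) (by constructor <;> norm_num)
    hf.aemeasurable ((measurable_one (α := ℝ≥0∞)).indicator hA).aemeasurable
  have e1 : (f * A.indicator (1 : α → ℝ≥0∞)) = A.indicator f := by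
    ext x; by_cases hx : x ∈ A <;> simp [hx]
  have e2 : ∀ x, (A.indicator (1 : α → ℝ≥0∞) x) ^ (2 : ℝ) = A.indicator 1 x := by
    intro x; by_cases hx : x ∈ A <;> simp [hx]
  rw [e1] at h2
  simp_rw [e2, lintegral_indicator_one hA, ENNReal.rpow_two] at h2
  calc (∫⁻ a, A.indicator f a ∂P) ^ 2
      ≤ ((∫⁻ a, f a ^ 2 ∂P) ^ (1 / 2 : ℝ) * P A ^ (1 / 2 : ℝ)) ^ 2 := by gcongr
    _ = _ := by
      rw [mul_pow, ← ENNReal.rpow_natCast, ← ENNReal.rpow_natCast, ← ENNReal.rpow_mul,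
        ← ENNReal.rpow_mul]
      norm_num

lemma gaussianReal_eq_withDensity_gaussianReal (m : ℝ) :
    gaussianReal m 1 = (gaussianReal 0 1).withDensity
      fun x => ENNReal.ofReal (Real.exp (m * x - m ^ 2 / 2)) := by
  rw [gaussianReal_of_var_ne_zero m one_ne_zero, gaussianReal_of_var_ne_zero 0 one_ne_zero,
    ← withDensity_mul _ (measurable_gaussianPDF 0 1) (by fun_prop)]
  congr 1
  ext x
  rw [Pi.mul_apply, gaussianPDF, gaussianPDF, ← ENNReal.ofReal_mul (gaussianPDFReal_nonneg _ _ _),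
    gaussianPDFReal, gaussianPDFReal, mul_assoc _ (Real.exp _), ← Real.exp_add]
  congr 3
  norm_num
  ring

lemma hasDensitySecondMoment_gaussianReal (m : ℝ) :
    HasDensitySecondMoment (gaussianReal 0 1) (gaussianReal m 1)
      (ENNReal.ofReal (Real.exp (m ^ 2))) := by
  refine ⟨_, by fun_prop, gaussianReal_eq_withDensity_gaussianReal m, ?_⟩
  -- the square of the density of `N(m, 1)` is `exp (m²)` times the density of `N(2m, 1)`
  have h : ∀ x : ℝ, ENNReal.ofReal (Real.exp (m * x - m ^ 2 / 2)) ^ 2 =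
      ENNReal.ofReal (Real.exp (m ^ 2)) *
        ENNReal.ofReal (Real.exp ((2 * m) * x - (2 * m) ^ 2 / 2)) := by
    intro x
    rw [← ENNReal.ofReal_pow (Real.exp_pos _).le, ← ENNReal.ofReal_mul (Real.exp_pos _).le,
      ← Real.exp_nat_mul, ← Real.exp_add]
    congr 2
    push_cast
    ring
  simp_rw [h]
  rw [lintegral_const_mul _ (by fun_prop), ← setLIntegral_univ, ← withDensity_apply _ .univ,
    ← gaussianReal_eq_withDensity_gaussianReal, measure_univ, mul_one]

lemma sq_sampleLaw_le {d n : ℕ} (μ : EuclideanSpace ℝ (Fin d))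
    {A : Set (Fin n → EuclideanSpace ℝ (Fin d))} (hA : MeasurableSet A) :
    sampleLaw n μ A ^ 2 ≤ ENNReal.ofReal (Real.exp (n * ‖μ‖ ^ 2)) * sampleLaw n 0 A := by
  have h : HasDensitySecondMoment (entryLaw n (0 : EuclideanSpace ℝ (Fin d))) (entryLaw n μ)
      (∏ _j : Fin n, ∏ i, ENNReal.ofReal (Real.exp (μ i ^ 2))) :=
    .pi fun _ => .pi fun i => hasDensitySecondMoment_gaussianReal (μ i)
  have hc : (∏ _j : Fin n, ∏ i, ENNReal.ofReal (Real.exp (μ i ^ 2))) =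
      ENNReal.ofReal (Real.exp (n * ‖μ‖ ^ 2)) := by
    rw [Finset.prod_const, Finset.card_univ, Fintype.card_fin,
      ← ENNReal.ofReal_prod_of_nonneg fun i _ => (Real.exp_pos _).le, ← Real.exp_sum,
      ← EuclideanSpace.real_norm_sq_eq, ← ENNReal.ofReal_pow (Real.exp_pos _).le,
      ← Real.exp_nat_mul]
  rw [sampleLaw_eq_map, sampleLaw_eq_map, Measure.map_apply measurable_toLp_comp hA,
    Measure.map_apply measurable_toLp_comp hA, ← hc]
  exact h.sq_measure_le (measurable_toLp_comp hA)

/-! ### Lower bound on the sample size -/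

/-- Volume comparison: a ball of `ℝ^k` of radius `R r` contains any number up to `R ^ k` of points
at mutual distance at least `r`. -/
lemma exists_separated_finset {k : ℕ} {r : ℝ} (hr : 0 < r) (R : ℝ) (hR : 0 < R) (m : ℕ)
    (hm : (m : ℝ) ≤ R ^ k) :
    ∃ s : Finset (EuclideanSpace ℝ (Fin k)), s.card = m ∧ (∀ x ∈ s, ‖x‖ ≤ R * r) ∧
      ∀ x ∈ s, ∀ y ∈ s, x ≠ y → r ≤ dist x y := by
  induction m with
  | zero => exact ⟨∅, by simp⟩
  | succ m ih =>
    obtain ⟨s, hcard, hnorm, hsep⟩ := ih (le_trans (by push_cast; linarith) hm)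
    -- the balls of radius `r` around the points chosen so far do not exhaust the large ball
    have hnot : ¬ Metric.closedBall (0 : EuclideanSpace ℝ (Fin k)) (R * r) ⊆
        ⋃ x ∈ s, Metric.ball x r := by
      intro hsub
      have h1 := (measure_mono (μ := volume) hsub).trans (measure_biUnion_finset_le s _)
      have hv : ∀ x ∈ s, volume (Metric.ball x r) = ENNReal.ofReal (r ^ k) *
          volume (Metric.ball (0 : EuclideanSpace ℝ (Fin k)) 1) := by
        intro x _
        rw [Measure.addHaar_ball_of_pos _ _ hr, finrank_euclideanSpace, Fintype.card_fin]
      rw [Finset.sum_congr rfl hv, Finset.sum_const, hcard, Measure.addHaar_closedBall _ _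
        (by positivity), finrank_euclideanSpace, Fintype.card_fin, nsmul_eq_mul, ← mul_assoc,
        ENNReal.mul_le_mul_iff_left (Metric.measure_ball_pos volume _ one_pos).ne'
          measure_ball_lt_top.ne, ← ENNReal.ofReal_natCast, ← ENNReal.ofReal_mul (by positivity),
        ENNReal.ofReal_le_ofReal_iff (by positivity), mul_pow] at h1
      have h2 : R ^ k ≤ m := le_of_mul_le_mul_right h1 (by positivity)
      push_cast at hm
      linarith
    obtain ⟨x, hx, hxs⟩ := Set.not_subset.1 hnot
    simp only [Set.mem_iUnion, Metric.mem_ball, not_exists, not_lt] at hxs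
    have hxns : x ∉ s := fun h => by
      have := hxs x h
      rw [dist_self] at this
      linarith
    refine ⟨insert x s, by rw [Finset.card_insert_of_notMem hxns, hcard], ?_, ?_⟩
    · intro y hy
      rcases Finset.mem_insert.1 hy with rfl | hy
      · simpa using hx
      · exact hnorm y hy
    · intro y hy z hz hyz
      rcases Finset.mem_insert.1 hy with hy' | hy' <;> rcases Finset.mem_insert.1 hz with hz' | hz'
      · exact absurd (hy'.trans hz'.symm) hyz
      · rw [hy']; exact hxs z hz'
      · rw [hz', dist_comm]; exact hxs y hy'
      · exact hsep y hy' z hz' hyz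

/-- The vector `x` of `ℝ^k`, padded with zeros to a vector of `ℝ^d` (meant for `k ≤ d`; otherwise
the last coordinates are dropped). -/
noncomputable def zeroPad {k : ℕ} (d : ℕ) (x : EuclideanSpace ℝ (Fin k)) :
    EuclideanSpace ℝ (Fin d) :=
  WithLp.toLp 2 fun i => if h : (i : ℕ) < k then x ⟨i, h⟩ else 0

lemma zeroPad_sub {k d : ℕ} (x y : EuclideanSpace ℝ (Fin k)) :
    zeroPad d (x - y) = zeroPad d x - zeroPad d y := by
  ext i
  by_cases h : (i : ℕ) < k <;> simp [zeroPad, h]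

lemma norm_zeroPad {k d : ℕ} (hkd : k ≤ d) (x : EuclideanSpace ℝ (Fin k)) :
    ‖zeroPad d x‖ = ‖x‖ := by
  rw [EuclideanSpace.norm_eq, EuclideanSpace.norm_eq]
  congr 1
  symm
  refine Finset.sum_of_injOn (Fin.castLE hkd) (Fin.castLE_injective hkd).injOn (by simp) ?_ ?_
  · intro i _ hi
    have : ¬ (i : ℕ) < k := fun h => hi ⟨⟨i, h⟩, by simp, by ext; simp⟩
    simp [zeroPad, this]
  · intro i _
    simp [zeroPad]

lemma isSparse_zeroPad {k d : ℕ} (hkd : k ≤ d) (x : EuclideanSpace ℝ (Fin k)) :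
    IsSparse k (zeroPad d x) := by
  have hsub : {i : Fin d | zeroPad d x i ≠ 0} ⊆ Set.range (Fin.castLE hkd) := by
    intro i hi
    have : (i : ℕ) < k := by
      by_contra h
      exact hi (by simp [zeroPad, h])
    exact ⟨⟨i, this⟩, by ext; simp⟩
  refine (Set.ncard_le_ncard hsub (Set.toFinite _)).trans ?_
  rw [← Set.image_univ]
  refine (Set.ncard_image_le (Set.toFinite _)).trans ?_
  simp [Set.ncard_univ]

lemma isCorruption_refl {d n : ℕ} {ε : ℝ} (hε : 0 ≤ ε) (X : Fin n → EuclideanSpace ℝ (Fin d)) :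
    IsCorruption ε X X :=
  ⟨1, by simpa using mul_nonneg hε n.cast_nonneg⟩

/-- The estimator succeeds on a measurable event, although it need not be measurable itself. -/
lemma Recovers.exists_measurableSet {d n k : ℕ} {ε r δ : ℝ}
    {T : (Fin n → EuclideanSpace ℝ (Fin d)) → EuclideanSpace ℝ (Fin d)}
    (hT : Recovers k ε r δ T) (hδ : 0 ≤ δ) {μ : EuclideanSpace ℝ (Fin d)} (hμ : IsSparse k μ) :
    ∃ G, MeasurableSet G ∧ (∀ X ∈ G, ∀ Y, IsCorruption ε X Y → ‖μ - T Y‖ ≤ r) ∧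
      1 - δ ≤ (sampleLaw n μ).real G := by
  set B := {X | ∃ Y, IsCorruption ε X Y ∧ r < ‖μ - T Y‖} with hB
  refine ⟨(toMeasurable (sampleLaw n μ) B)ᶜ, (measurableSet_toMeasurable _ _).compl, ?_, ?_⟩
  · intro X hX Y hXY
    by_contra h
    exact hX (subset_toMeasurable _ _ ⟨Y, hXY, not_le.1 h⟩)
  · rw [probReal_compl_eq_one_sub (measurableSet_toMeasurable _ _), measureReal_def,
      measure_toMeasurable]
    have := ENNReal.toReal_mono ENNReal.ofReal_ne_top (hT μ hμ)
    rw [ENNReal.toReal_ofReal hδ] at this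
    linarith

lemma sq_sampleLaw_real_le {d n : ℕ} (μ : EuclideanSpace ℝ (Fin d))
    {A : Set (Fin n → EuclideanSpace ℝ (Fin d))} (hA : MeasurableSet A) :
    (sampleLaw n μ).real A ^ 2 ≤ Real.exp (n * ‖μ‖ ^ 2) * (sampleLaw n 0).real A := by
  have h := ENNReal.toReal_mono (ENNReal.mul_ne_top ENNReal.ofReal_ne_top (measure_ne_top _ _))
    (sq_sampleLaw_le μ hA)
  rwa [ENNReal.toReal_mul, ENNReal.toReal_pow, ENNReal.toReal_ofReal (Real.exp_pos _).le] at h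

/-- Dimension part: the success events of exponentially many separated means are disjoint, and
each has probability at least `exp (-n ‖μ‖²) / 4` under the mean `0`. -/
lemma Recovers.dim_le {d n k : ℕ} {r δ : ℝ} (hkd : k ≤ d) (hk : 1 ≤ k) (hr : 0 < r) (hδ0 : 0 ≤ δ)
    (hδ : δ ≤ 1 / 2) {T : (Fin n → EuclideanSpace ℝ (Fin d)) → EuclideanSpace ℝ (Fin d)}
    (hT : Recovers k 0 r δ T) : (k : ℝ) ≤ 2 * (n * (24 * r) ^ 2) := by
  obtain ⟨s, hcard, hnorm, hsep⟩ := exists_separated_finset (k := k) (r := 3 * r) (by positivity)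
    8 (by norm_num) (8 ^ k) (by simp)
  choose! G hGm hG hGp using fun x : EuclideanSpace ℝ (Fin k) =>
    hT.exists_measurableSet hδ0 (isSparse_zeroPad hkd x)
  have hdisj : (s : Set (EuclideanSpace ℝ (Fin k))).PairwiseDisjoint G := by
    intro x hx y hy hxy
    refine Set.disjoint_left.2 fun X hXx hXy => ?_
    have h1 := hG x X hXx X (isCorruption_refl le_rfl X)
    have h2 := hG y X hXy X (isCorruption_refl le_rfl X)
    have h3 := hsep x hx y hy hxy
    rw [dist_eq_norm, ← norm_zeroPad hkd, zeroPad_sub] at h3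
    rw [norm_sub_rev] at h2
    have := norm_sub_le_norm_sub_add_norm_sub (zeroPad d x) (T X) (zeroPad d y)
    linarith
  have hlow : ∀ x ∈ s, Real.exp (-(n * (24 * r) ^ 2)) / 4 ≤ (sampleLaw n 0).real (G x) := by
    intro x hx
    have h1 := sq_sampleLaw_real_le (zeroPad d x) (hGm x)
    have h2 := hGp x
    rw [norm_zeroPad hkd] at h1
    have h3 : Real.exp (n * ‖x‖ ^ 2) ≤ Real.exp (n * (24 * r) ^ 2) := by
      have := hnorm x hx
      gcongr
      linarith
    rw [Real.exp_neg, div_le_iff₀ (by norm_num), inv_le_iff_one_le_mul₀ (Real.exp_pos _)]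
    have h4 : (1 / 2 : ℝ) ^ 2 ≤ (sampleLaw n (zeroPad d x)).real (G x) ^ 2 := by
      gcongr; linarith
    have h5 := h1.trans (mul_le_mul_of_nonneg_right h3 measureReal_nonneg)
    nlinarith
  have hsum : ∑ x ∈ s, (sampleLaw n 0).real (G x) ≤ 1 := by
    rw [← measureReal_biUnion_finset hdisj fun x _ => hGm x]
    exact measureReal_le_one
  have h1 := (Finset.card_nsmul_le_sum s _ _ hlow).trans hsum
  rw [hcard, nsmul_eq_mul, Real.exp_neg] at h1
  push_cast at h1
  have h2 : (8 : ℝ) ^ k ≤ 4 * Real.exp (n * (24 * r) ^ 2) := by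
    rw [mul_div_assoc', div_le_iff₀ (by norm_num), mul_inv_le_iff₀ (Real.exp_pos _)] at h1
    linarith
  -- `8 ^ k = 4 ^ k * 2 ^ k`, where the factor `4 ^ k` absorbs the constant `4`
  have h3 : (4 : ℝ) ≤ 4 ^ k := le_self_pow₀ (by norm_num) (by omega)
  have h4 : (2 : ℝ) ^ k ≤ Real.exp (n * (24 * r) ^ 2) := by
    have : (8 : ℝ) ^ k = 4 ^ k * 2 ^ k := by rw [← mul_pow]; norm_num
    rw [this] at h2
    have : (0 : ℝ) < 2 ^ k := by positivity
    nlinarith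
  have h5 := Real.log_le_log (by positivity) h4
  rw [Real.log_exp, Real.log_pow] at h5
  have := Real.log_two_gt_d9
  have : (1 : ℝ) ≤ k := by exact_mod_cast hk
  nlinarith

/-- Confidence part: two means at distance `3 r` cannot be told apart too reliably. -/
lemma Recovers.log_le {d n k : ℕ} {r δ : ℝ} (hkd : k ≤ d) (hk : 1 ≤ k) (hr : 0 < r) (hδ0 : 0 < δ)
    (hδ : δ ≤ 1 / 2) {T : (Fin n → EuclideanSpace ℝ (Fin d)) → EuclideanSpace ℝ (Fin d)}
    (hT : Recovers k 0 r δ T) : Real.log (1 / δ) ≤ n * (3 * r) ^ 2 + 2 := by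
  set μ : EuclideanSpace ℝ (Fin d) :=
    zeroPad d (EuclideanSpace.single (⟨0, hk⟩ : Fin k) (3 * r)) with hμ
  have hμn : ‖μ‖ = 3 * r := by
    rw [hμ, norm_zeroPad hkd, PiLp.norm_single, Real.norm_of_nonneg (by positivity)]
  obtain ⟨G, hGm, hG, hGp⟩ := hT.exists_measurableSet hδ0.le
    (isSparse_zeroPad hkd (EuclideanSpace.single (⟨0, hk⟩ : Fin k) (3 * r)))
  have hz : IsSparse k (0 : EuclideanSpace ℝ (Fin d)) := by simp [IsSparse]
  obtain ⟨G', hGm', hG', hGp'⟩ := hT.exists_measurableSet hδ0.le hz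
  have hdisj : Disjoint G G' := by
    refine Set.disjoint_left.2 fun X hX hX' => ?_
    have h1 := hG X hX X (isCorruption_refl le_rfl X)
    have h2 := hG' X hX' X (isCorruption_refl le_rfl X)
    rw [← hμ] at h1
    rw [norm_sub_rev] at h2
    have := norm_sub_le_norm_sub_add_norm_sub μ (T X) 0
    rw [sub_zero, hμn] at this
    linarith
  have h0 : (sampleLaw n 0).real G ≤ δ := by
    have h1 := measureReal_union (μ := sampleLaw n 0) hdisj hGm'
    have h2 : (sampleLaw n (0 : EuclideanSpace ℝ (Fin d))).real (G ∪ G') ≤ 1 := measureReal_le_one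
    linarith
  have h1 := sq_sampleLaw_real_le μ hGm
  rw [hμn] at h1
  have h2 : (1 / 2 : ℝ) ^ 2 ≤ (sampleLaw n μ).real G ^ 2 := by
    gcongr
    linarith
  have h3 : 1 / δ ≤ 4 * Real.exp (n * (3 * r) ^ 2) := by
    rw [div_le_iff₀ hδ0]
    nlinarith [mul_le_mul_of_nonneg_left h0 (Real.exp_pos (n * (3 * r) ^ 2)).le]
  have h4 := Real.log_le_log (by positivity) h3
  rw [Real.log_mul (by norm_num) (Real.exp_pos _).ne', Real.log_exp] at h4
  have h5 : Real.log 4 ≤ 2 := by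
    rw [show (4 : ℝ) = 2 ^ 2 by norm_num, Real.log_pow]
    have := Real.log_two_lt_d9
    push_cast
    linarith
  linarith

theorem sample_size_lower_bound (K : ℝ) (hK : 0 < K) : ∃ c : ℝ, 0 < c ∧
      ∀ (d k n : ℕ) (ε δ : ℝ), 1 ≤ k → k ≤ d → 0 < ε → 0 < δ → δ ≤ 1 / 2 →
        ∀ T : (Fin n → EuclideanSpace ℝ (Fin d)) → EuclideanSpace ℝ (Fin d),
          Recovers k 0 (K * ε) δ T →
          c * ((k + Real.log (1 / δ)) / ε ^ 2) ≤ n := by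
  refine ⟨1 / (4000 * K ^ 2), by positivity, fun d k n ε δ hk hkd hε hδ0 hδ T hT => ?_⟩
  have hr : 0 < K * ε := by positivity
  have h1 := hT.dim_le hkd hk hr hδ0.le hδ
  have h2 := hT.log_le hkd hk hr hδ0 hδ
  have h3 : (1 : ℝ) ≤ k := by exact_mod_cast hk
  rw [div_mul_div_comm, one_mul, div_le_iff₀ (by positivity)]
  nlinarith

/-! ### Lower bound on the error -/

/-- Standard Gaussian noise `x` together with an independent uniform variable `u` on `[0, 1]`. -/
noncomputable def couplingLaw : Measure (ℝ × ℝ) :=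
  (gaussianReal 0 1).prod (volume.restrict (Set.Icc 0 1))

instance : IsProbabilityMeasure (volume.restrict (Set.Icc (0 : ℝ) 1)) :=
  ⟨by simp⟩

instance : IsProbabilityMeasure couplingLaw := by
  unfold couplingLaw; infer_instance

/-- The density of `N(s, 1)` with respect to `N(0, 1)`. -/
noncomputable def shiftDensity (s x : ℝ) : ℝ := Real.exp (s * x - s ^ 2 / 2)

lemma shiftDensity_pos (s x : ℝ) : 0 < shiftDensity s x := Real.exp_pos _

lemma measurable_shiftDensity (s : ℝ) : Measurable (shiftDensity s) := by
  unfold shiftDensity; fun_prop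

lemma shiftDensity_sub (s x : ℝ) : shiftDensity s (s - x) = (shiftDensity s x)⁻¹ := by
  rw [shiftDensity, shiftDensity, ← Real.exp_neg]
  congr 1
  ring

lemma gaussianReal_eq_withDensity_shiftDensity (s : ℝ) :
    gaussianReal s 1 = (gaussianReal 0 1).withDensity fun x => ENNReal.ofReal (shiftDensity s x) :=
  gaussianReal_eq_withDensity_gaussianReal s

/-- The reflection coupling of `N(0, 1)` and `N(s, 1)`: the point `x` is kept with probability
`min 1 (shiftDensity s x)`, and reflected about `s / 2` otherwise. -/
noncomputable def reflectionCoupling (s : ℝ) (p : ℝ × ℝ) : ℝ :=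
  if p.2 ≤ shiftDensity s p.1 then p.1 else s - p.1

lemma measurable_reflectionCoupling (s : ℝ) : Measurable (reflectionCoupling s) := by
  refine Measurable.ite ?_ measurable_fst (by fun_prop)
  exact measurableSet_le measurable_snd ((measurable_shiftDensity s).comp measurable_fst)

lemma volume_restrict_Icc_le (ρ : ℝ) :
    volume.restrict (Set.Icc (0 : ℝ) 1) {u | u ≤ ρ} = ENNReal.ofReal (min 1 ρ) := by
  have hm : MeasurableSet {u : ℝ | u ≤ ρ} := measurableSet_le measurable_id measurable_const
  rw [Measure.restrict_apply hm]
  have : {u : ℝ | u ≤ ρ} ∩ Set.Icc 0 1 = Set.Icc 0 (min 1 ρ) := by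
    ext u; simp only [Set.mem_inter_iff, Set.mem_ofPred_eq, Set.mem_Icc, le_min_iff]; tauto
  rw [this, Real.volume_Icc, sub_zero]

lemma volume_restrict_Icc_gt {ρ : ℝ} (hρ : 0 ≤ ρ) :
    volume.restrict (Set.Icc (0 : ℝ) 1) {u | ρ < u} = ENNReal.ofReal (1 - min 1 ρ) := by
  have : {u : ℝ | ρ < u} = {u | u ≤ ρ}ᶜ := by ext; simp
  have hm : MeasurableSet {u : ℝ | u ≤ ρ} := measurableSet_le measurable_id measurable_const
  rw [this, prob_compl_eq_one_sub hm, volume_restrict_Icc_le,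
    ENNReal.ofReal_sub _ (by positivity), ENNReal.ofReal_one]

lemma map_reflectionCoupling (s : ℝ) :
    couplingLaw.map (reflectionCoupling s) = gaussianReal s 1 := by
  ext B hB
  have hρ := measurable_shiftDensity s
  have hBs : Measurable fun x : ℝ => B.indicator (1 : ℝ → ℝ≥0∞) x := measurable_one.indicator hB
  rw [Measure.map_apply (measurable_reflectionCoupling s) hB, couplingLaw,
    Measure.prod_apply (measurable_reflectionCoupling s hB)]
  have hinner : ∀ x, volume.restrict (Set.Icc (0 : ℝ) 1)
      (Prod.mk x ⁻¹' (reflectionCoupling s ⁻¹' B)) =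
      B.indicator 1 x * ENNReal.ofReal (min 1 (shiftDensity s x)) +
        B.indicator 1 (s - x) * ENNReal.ofReal (1 - min 1 (shiftDensity s x)) := by
    intro x
    have hset : Prod.mk x ⁻¹' (reflectionCoupling s ⁻¹' B) =
        {u | u ≤ shiftDensity s x ∧ x ∈ B} ∪ {u | shiftDensity s x < u ∧ s - x ∈ B} := by
      ext u
      simp only [Set.mem_preimage, reflectionCoupling, Set.mem_union, Set.mem_ofPred_eq]
      split_ifs with h
      · simp [h, not_lt.2 h]
      · simp [h, not_le.1 h]
    rw [hset, measure_union]
    · congr 1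
      · by_cases hx : x ∈ B
        · simp only [hx, and_true, Set.indicator_of_mem, Pi.one_apply, one_mul]
          exact volume_restrict_Icc_le _
        · simp [hx]
      · by_cases hx : s - x ∈ B
        · simp [hx, volume_restrict_Icc_gt (shiftDensity_pos s x).le]
        · simp [hx]
    · refine Set.disjoint_left.2 fun u hu hu' => ?_
      exact absurd hu.1 (not_le.2 hu'.1)
    · by_cases hx : s - x ∈ B
      · simpa [hx] using measurableSet_lt measurable_const measurable_id
      · simp [hx]
  simp_rw [hinner]
  have hkeep : Measurable fun x => B.indicator (1 : ℝ → ℝ≥0∞) x *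
      ENNReal.ofReal (min 1 (shiftDensity s x)) := hBs.mul (by fun_prop)
  rw [lintegral_add_left hkeep]
  -- the substitution `x ↦ s - x` turns the reflected part into an integral against `N(s, 1)`
  have hrefl : ∫⁻ x, B.indicator 1 (s - x) * ENNReal.ofReal (1 - min 1 (shiftDensity s x))
      ∂(gaussianReal 0 1) = ∫⁻ y, ENNReal.ofReal (shiftDensity s y) *
        (B.indicator 1 y * ENNReal.ofReal (1 - min 1 (shiftDensity s y)⁻¹))
          ∂(gaussianReal 0 1) := by
    have hg : Measurable fun y => B.indicator (1 : ℝ → ℝ≥0∞) y *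
        ENNReal.ofReal (1 - min 1 (shiftDensity s y)⁻¹) := hBs.mul (by fun_prop)
    have hwd := lintegral_withDensity_eq_lintegral_mul (gaussianReal 0 1)
      (f := fun y => ENNReal.ofReal (shiftDensity s y)) (by fun_prop) hg
    simp only [Pi.mul_apply] at hwd
    rw [← hwd, ← gaussianReal_eq_withDensity_shiftDensity]
    have hmap : gaussianReal s 1 = (gaussianReal 0 1).map (s - ·) := by
      rw [gaussianReal_map_const_sub, sub_zero]
    rw [hmap, lintegral_map hg (by fun_prop)]
    simp_rw [shiftDensity_sub, inv_inv]
  rw [hrefl, ← lintegral_add_left hkeep, gaussianReal_eq_withDensity_shiftDensity s,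
    withDensity_apply _ hB, ← lintegral_indicator hB]
  refine lintegral_congr fun x => ?_
  by_cases hx : x ∈ B
  · have hpos := shiftDensity_pos s x
    simp only [hx, Set.indicator_of_mem, Pi.one_apply, one_mul]
    rw [← ENNReal.ofReal_mul hpos.le, ← ENNReal.ofReal_add (by positivity)
      (mul_nonneg hpos.le (sub_nonneg.2 (min_le_left _ _)))]
    congr 1
    rcases le_total 1 (shiftDensity s x) with h | h
    · rw [min_eq_left h, min_eq_right (inv_le_one_of_one_le₀ h)]
      field_simp
      ring
    · rw [min_eq_right h, min_eq_left ((one_le_inv₀ hpos).2 h)]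
      ring
  · simp [hx]

lemma couplingLaw_ne_le (s : ℝ) :
    couplingLaw {p | reflectionCoupling s p ≠ p.1} ≤ ENNReal.ofReal (2 * |s|) := by
  by_cases hs : 1 ≤ |s|
  · exact prob_le_one.trans (ENNReal.one_le_ofReal.2 (by linarith))
  have hρ := measurable_shiftDensity s
  have hsub : {p | reflectionCoupling s p ≠ p.1} ⊆ {p : ℝ × ℝ | shiftDensity s p.1 < p.2} := by
    intro p hp
    by_contra h
    exact hp (if_pos (not_lt.1 h))
  have hm : MeasurableSet {p : ℝ × ℝ | shiftDensity s p.1 < p.2} :=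
    measurableSet_lt (hρ.comp measurable_fst) measurable_snd
  refine (measure_mono hsub).trans ?_
  rw [couplingLaw, Measure.prod_apply hm]
  have hx2 : Integrable (fun x : ℝ => x ^ 2) (gaussianReal 0 1) :=
    (memLp_id_gaussianReal' (μ := 0) (v := 1) 2 (by simp)).integrable_sq
  have hint : Integrable (fun x : ℝ => |s| * ((1 + x ^ 2) / 2) + s ^ 2 / 2) (gaussianReal 0 1) :=
    (((integrable_const 1).add hx2).div_const 2 |>.const_mul _).add (integrable_const _)
  calc ∫⁻ x, volume.restrict (Set.Icc (0 : ℝ) 1)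
        (Prod.mk x ⁻¹' {p : ℝ × ℝ | shiftDensity s p.1 < p.2}) ∂(gaussianReal 0 1)
      ≤ ∫⁻ x, ENNReal.ofReal (|s| * ((1 + x ^ 2) / 2) + s ^ 2 / 2) ∂(gaussianReal 0 1) := by
        refine lintegral_mono fun x => ?_
        simp only [Set.preimage_ofPred_eq]
        rw [volume_restrict_Icc_gt (shiftDensity_pos s x).le]
        refine ENNReal.ofReal_le_ofReal ?_
        have h1 : 1 - (s * x - s ^ 2 / 2) ≥ 1 - |s| * ((1 + x ^ 2) / 2) := by
          have h2 : s * x ≤ |s| * |x| := by rw [← abs_mul]; exact le_abs_self _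
          have h3 : |x| ≤ (1 + x ^ 2) / 2 := by nlinarith [sq_nonneg (|x| - 1), sq_abs x]
          nlinarith [mul_le_mul_of_nonneg_left h3 (abs_nonneg s), sq_nonneg s]
        rcases le_total 1 (shiftDensity s x) with h | h
        · rw [min_eq_left h]
          rw [sub_self]; positivity
        · rw [min_eq_right h]
          have h4 := Real.add_one_le_exp (s * x - s ^ 2 / 2)
          have h2 : -(s * x) ≤ |s| * |x| := by rw [← abs_mul]; exact neg_le_abs _
          have h3 : |x| ≤ (1 + x ^ 2) / 2 := by nlinarith [sq_nonneg (|x| - 1), sq_abs x]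
          have h5 := mul_le_mul_of_nonneg_left h3 (abs_nonneg s)
          rw [shiftDensity]
          linarith
    _ = ENNReal.ofReal (|s| + s ^ 2 / 2) := by
        rw [← ofReal_integral_eq_lintegral_ofReal hint (.of_forall fun x => by positivity)]
        have hv : ∫ x : ℝ, x ^ 2 ∂(gaussianReal 0 1) = 1 := by
          have := variance_fun_id_gaussianReal (μ := 0) (v := 1)
          rw [variance_of_integral_eq_zero (by fun_prop) (by simp)] at this
          simpa using this
        have hi1 : Integrable (fun x : ℝ => |s| * ((1 + x ^ 2) / 2)) (gaussianReal 0 1) :=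
          ((integrable_const 1).add hx2).div_const 2 |>.const_mul _
        rw [integral_add hi1 (integrable_const _), integral_const_mul, integral_div,
          integral_add (integrable_const _) hx2, hv]
        congr 1
        simp
    _ ≤ ENNReal.ofReal (2 * |s|) := by
        refine ENNReal.ofReal_le_ofReal ?_
        nlinarith [sq_abs s, abs_nonneg s]

/-- A sample built from coupling variables, one for each entry: the entries in column `i₀` are
obtained with the function `a`, the others are the noise itself. -/
noncomputable def coupledSample {d n : ℕ} (i₀ : Fin d) (a : ℝ × ℝ → ℝ)
    (ω : Fin n → Fin d → ℝ × ℝ) : Fin n → EuclideanSpace ℝ (Fin d) :=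
  fun j => WithLp.toLp 2 fun i => (if i = i₀ then a else Prod.fst) (ω j i)

/-- The law of the coupling variables for all entries of the sample. -/
noncomputable def couplingSampleLaw (d n : ℕ) : Measure (Fin n → Fin d → ℝ × ℝ) :=
  Measure.pi fun _ => Measure.pi fun _ => couplingLaw

instance (d n : ℕ) : IsProbabilityMeasure (couplingSampleLaw d n) := by
  unfold couplingSampleLaw; infer_instance

lemma map_fst_couplingLaw : couplingLaw.map Prod.fst = gaussianReal 0 1 := by
  rw [couplingLaw, Measure.map_fst_prod, measure_univ, one_smul]

lemma measurable_coupledSample {d n : ℕ} (i₀ : Fin d) {a : ℝ × ℝ → ℝ} (ha : Measurable a) :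
    Measurable (coupledSample (n := n) i₀ a) := by
  have h : ∀ i : Fin d, Measurable (if i = i₀ then a else Prod.fst) := by
    intro i; split_ifs <;> fun_prop
  refine measurable_toLp_comp.comp
    (measurable_pi_lambda _ fun j => measurable_pi_lambda _ fun i => ?_)
  exact (h i).comp ((measurable_pi_apply i).comp (measurable_pi_apply j))

lemma map_coupledSample {d n : ℕ} (i₀ : Fin d) {a : ℝ × ℝ → ℝ} (ha : Measurable a) {m : ℝ}
    (hm : couplingLaw.map a = gaussianReal m 1) :
    (couplingSampleLaw d n).map (coupledSample i₀ a) =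
      sampleLaw n (EuclideanSpace.single i₀ m) := by
  have h : ∀ i : Fin d, Measurable (if i = i₀ then a else Prod.fst) := by
    intro i; split_ifs <;> fun_prop
  have hlaw : ∀ i : Fin d, couplingLaw.map (if i = i₀ then a else Prod.fst) =
      gaussianReal ((EuclideanSpace.single i₀ m : EuclideanSpace ℝ (Fin d)) i) 1 := by
    intro i
    by_cases hi : i = i₀
    · simp [hi, hm]
    · simp [hi, map_fst_couplingLaw]
  have hrow : (Measure.pi fun _ : Fin d => couplingLaw).map
      (fun x i => (if i = i₀ then a else Prod.fst) (x i)) =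
      Measure.pi fun i => gaussianReal
        ((EuclideanSpace.single i₀ m : EuclideanSpace ℝ (Fin d)) i) 1 := by
    have : ∀ i : Fin d, IsProbabilityMeasure (couplingLaw.map (if i = i₀ then a else Prod.fst)) :=
      fun i => Measure.isProbabilityMeasure_map (h i).aemeasurable
    rw [Measure.pi_map_pi fun i => (h i).aemeasurable]
    simp_rw [hlaw]
  have hrowm : Measurable fun (x : Fin d → ℝ × ℝ) i => (if i = i₀ then a else Prod.fst) (x i) :=
    measurable_pi_lambda _ fun i => (h i).comp (measurable_pi_apply i)
  have hall : (couplingSampleLaw d n).map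
      (fun ω j i => (if i = i₀ then a else Prod.fst) (ω j i)) =
      entryLaw n (EuclideanSpace.single i₀ m) := by
    have : IsProbabilityMeasure ((Measure.pi fun _ : Fin d => couplingLaw).map
        (fun x i => (if i = i₀ then a else Prod.fst) (x i))) :=
      Measure.isProbabilityMeasure_map hrowm.aemeasurable
    rw [couplingSampleLaw, Measure.pi_map_pi
      (f := fun (_ : Fin n) (x : Fin d → ℝ × ℝ) i => (if i = i₀ then a else Prod.fst) (x i))
      fun _ => hrowm.aemeasurable, hrow]
    rfl
  rw [sampleLaw_eq_map, ← hall, Measure.map_map measurable_toLp_comp]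
  · rfl
  · exact measurable_pi_lambda _ fun j => hrowm.comp (measurable_pi_apply j)

/-- The adversary can turn the sample for the mean `s` into the sample for the mean `0`, except
with small probability: Markov's inequality for the number of rows in which the two differ. No
lower bound on `n` is needed. -/
lemma exists_small_event_isCorruption {d n : ℕ} (i₀ : Fin d) {ε s : ℝ} (hε : 0 < ε) :
    ∃ D : Set (Fin n → Fin d → ℝ × ℝ), MeasurableSet D ∧
      (couplingSampleLaw d n).real D ≤ 2 * |s| / ε ∧
      ∀ ω ∉ D, IsCorruption ε (coupledSample i₀ (reflectionCoupling s) ω)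
        (coupledSample i₀ Prod.fst ω) := by
  set S : Set (ℝ × ℝ) := {p | reflectionCoupling s p ≠ p.1} with hS
  have hSm : MeasurableSet S :=
    (measurableSet_eq_fun (measurable_reflectionCoupling s) measurable_fst).compl
  have hentry : ∀ j : Fin n, Measurable fun ω : Fin n → Fin d → ℝ × ℝ => ω j i₀ :=
    fun j => (measurable_pi_apply i₀).comp (measurable_pi_apply j)
  set f : (Fin n → Fin d → ℝ × ℝ) → ℝ≥0∞ := fun ω => ∑ j, S.indicator 1 (ω j i₀) with hf
  have hfm : Measurable f :=
    Finset.measurable_sum _ fun j _ => (measurable_one.indicator hSm).comp (hentry j)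
  have hcount : ∀ ω, f ω = ({j | ω j i₀ ∈ S}.ncard : ℝ≥0∞) := by
    intro ω
    classical
    have : {j | ω j i₀ ∈ S} = ((Finset.univ.filter fun j => ω j i₀ ∈ S : Finset (Fin n)) :
      Set (Fin n)) := by ext; simp
    rw [this, Set.ncard_coe_finset, hf, Finset.card_filter]
    push_cast
    refine Finset.sum_congr rfl fun j _ => ?_
    by_cases h : ω j i₀ ∈ S <;> simp [h]
  have hint : ∫⁻ ω, f ω ∂(couplingSampleLaw d n) ≤ n * ENNReal.ofReal (2 * |s|) := by
    have hj : ∀ j : Fin n, Measurable fun ω : Fin n → Fin d → ℝ × ℝ =>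
        S.indicator (1 : ℝ × ℝ → ℝ≥0∞) (ω j i₀) :=
      fun j => (measurable_one.indicator hSm).comp (hentry j)
    rw [hf, lintegral_finsetSum _ fun j _ => hj j]
    have : ∀ j : Fin n, ∫⁻ ω, S.indicator 1 (ω j i₀) ∂(couplingSampleLaw d n) = couplingLaw S := by
      intro j
      have h1 : MeasurePreserving (fun ω : Fin n → Fin d → ℝ × ℝ => ω j i₀)
          (couplingSampleLaw d n) couplingLaw :=
        (measurePreserving_eval (fun _ : Fin d => couplingLaw) i₀).comp
          (measurePreserving_eval (fun _ : Fin n => Measure.pi fun _ : Fin d => couplingLaw) j)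
      rw [h1.lintegral_comp (measurable_one.indicator hSm), lintegral_indicator_one hSm]
    simp_rw [this]
    rw [Finset.sum_const, Finset.card_univ, Fintype.card_fin, nsmul_eq_mul]
    gcongr
    exact couplingLaw_ne_le s
  refine ⟨{ω | ENNReal.ofReal (ε * n) < f ω}, measurableSet_lt measurable_const hfm, ?_, ?_⟩
  · rcases Nat.eq_zero_or_pos n with rfl | hn
    · have : {ω : Fin 0 → Fin d → ℝ × ℝ | ENNReal.ofReal (ε * (0 : ℕ)) < f ω} = ∅ := by
        ext ω; simp [hf]
      rw [this, measureReal_empty]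
      positivity
    · have hn' : (0 : ℝ) < n := by exact_mod_cast hn
      have h1 := (mul_meas_ge_le_lintegral hfm (ENNReal.ofReal (ε * n))).trans hint
      have h2 : ENNReal.ofReal (ε * n) * (couplingSampleLaw d n) {ω | ENNReal.ofReal (ε * n) < f ω}
          ≤ n * ENNReal.ofReal (2 * |s|) := by
        refine le_trans ?_ h1
        gcongr
        exact fun h => h.le
      have h3 := ENNReal.toReal_mono (by finiteness) h2
      rw [ENNReal.toReal_mul, ENNReal.toReal_mul, ENNReal.toReal_ofReal (by positivity),
        ENNReal.toReal_ofReal (by positivity), ENNReal.toReal_natCast, ← measureReal_def] at h3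
      rw [le_div_iff₀ hε]
      refine le_of_mul_le_mul_left ?_ hn'
      linarith
  · intro ω hω
    refine ⟨1, ?_⟩
    rw [Set.mem_ofPred_eq, not_lt, hcount, ← ENNReal.ofReal_natCast,
      ENNReal.ofReal_le_ofReal_iff (by positivity)] at hω
    refine le_trans ?_ hω
    norm_cast
    refine Set.ncard_le_ncard (fun j hj => ?_) (Set.toFinite _)
    by_contra h
    refine hj ?_
    have h' : reflectionCoupling s (ω j i₀) = (ω j i₀).1 := not_not.1 h
    simp only [coupledSample, id_eq]
    congr 1
    ext i
    by_cases hi : i = i₀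
    · subst hi; simp [h']
    · simp [hi]

lemma isSparse_single {d k : ℕ} (hk : 1 ≤ k) (i₀ : Fin d) (s : ℝ) :
    IsSparse k (EuclideanSpace.single i₀ s) := by
  refine le_trans ?_ hk
  rw [← Set.ncard_singleton i₀]
  refine Set.ncard_le_ncard (fun i hi => ?_) (Set.toFinite _)
  by_contra h
  exact hi (by simp [show i ≠ i₀ from h])

theorem error_lower_bound : ∃ c : ℝ, 0 < c ∧
      ∀ (d k n : ℕ) (ε δ : ℝ), 1 ≤ d → 1 ≤ k → 0 < ε → δ < 1 / 2 →
        ∀ T : (Fin n → EuclideanSpace ℝ (Fin d)) → EuclideanSpace ℝ (Fin d),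
          ¬ Recovers k ε (c * ε) δ T := by
  -- the means `0` and `± ε / 8` are further apart than twice the error `ε / 32`
  refine ⟨1 / 32, by norm_num, fun d k n ε δ' hd hk hε hδ' T hT' => ?_⟩
  -- a negative `δ'` acts as `0` in `Recovers`
  obtain ⟨δ, hδ0, hδ, hT⟩ : ∃ δ : ℝ, 0 ≤ δ ∧ δ < 1 / 2 ∧ Recovers k ε (1 / 32 * ε) δ T :=
    ⟨max δ' 0, le_max_right _ _, max_lt hδ' (by norm_num),
      fun μ hμ => (hT' μ hμ).trans (ENNReal.ofReal_le_ofReal (le_max_left _ _))⟩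
  set i₀ : Fin d := ⟨0, hd⟩
  set P := couplingSampleLaw d n
  -- an event on which `T`, applied to the sample for the mean `0`, is close to the mean `s`
  have key : ∀ s : ℝ, |s| = ε / 8 → ∃ E, MeasurableSet E ∧ 1 - δ - 1 / 4 ≤ P.real E ∧
      ∀ ω ∈ E, ‖EuclideanSpace.single i₀ s - T (coupledSample i₀ Prod.fst ω)‖ ≤ 1 / 32 * ε := by
    intro s hs
    obtain ⟨D, hDm, hDp, hD⟩ := exists_small_event_isCorruption (n := n) i₀ (s := s) hε
    obtain ⟨G, hGm, hG, hGp⟩ := hT.exists_measurableSet hδ0 (isSparse_single hk i₀ s)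
    have hXm := measurable_coupledSample (n := n) i₀ (measurable_reflectionCoupling s)
    refine ⟨coupledSample i₀ (reflectionCoupling s) ⁻¹' G \ D, (hXm hGm).diff hDm, ?_, ?_⟩
    · rw [← map_coupledSample i₀ (measurable_reflectionCoupling s) (map_reflectionCoupling s),
        map_measureReal_apply hXm hGm] at hGp
      have h1 : 2 * |s| / ε = 1 / 4 := by rw [hs]; field_simp; norm_num
      have h2 := le_measureReal_sdiff (μ := P) (s₁ := coupledSample i₀ (reflectionCoupling s) ⁻¹' G)
        (s₂ := D)
      linarith
    · exact fun ω hω => hG _ hω.1 _ (hD ω hω.2)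
  obtain ⟨E₁, hm₁, hp₁, hE₁⟩ := key (ε / 8) (abs_of_pos (by positivity))
  obtain ⟨E₂, hm₂, hp₂, hE₂⟩ := key (-(ε / 8)) (by rw [abs_neg, abs_of_pos (by positivity)])
  obtain ⟨G, hGm, hG, hGp⟩ := hT.exists_measurableSet hδ0 (isSparse_single hk i₀ 0)
  have hXm := measurable_coupledSample (n := n) i₀ measurable_fst
  rw [← map_coupledSample i₀ measurable_fst map_fst_couplingLaw,
    map_measureReal_apply hXm hGm] at hGp
  set E₀ := coupledSample i₀ Prod.fst ⁻¹' G
  have hE₀ : ∀ ω ∈ E₀, ‖EuclideanSpace.single i₀ (0 : ℝ) - T (coupledSample i₀ Prod.fst ω)‖ ≤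
      1 / 32 * ε := fun ω hω => hG _ hω _ (isCorruption_refl hε.le _)
  have hsep : ∀ {s t : ℝ} {v : EuclideanSpace ℝ (Fin d)}, ε / 8 ≤ |s - t| →
      ‖EuclideanSpace.single i₀ s - v‖ ≤ 1 / 32 * ε →
      ‖EuclideanSpace.single i₀ t - v‖ ≤ 1 / 32 * ε → False := by
    intro s t v hst h1 h2
    have h3 := norm_sub_le_norm_sub_add_norm_sub (EuclideanSpace.single i₀ s) v
      (EuclideanSpace.single i₀ t)
    rw [norm_sub_rev v, ← PiLp.single_sub, PiLp.norm_single, Real.norm_eq_abs] at h3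
    linarith
  have hd01 : Disjoint E₀ E₁ := Set.disjoint_left.2 fun ω h h' =>
    hsep (by rw [zero_sub, abs_neg, abs_of_pos (by positivity)]) (hE₀ ω h) (hE₁ ω h')
  have hd02 : Disjoint E₀ E₂ := Set.disjoint_left.2 fun ω h h' =>
    hsep (by rw [zero_sub, neg_neg, abs_of_pos (by positivity)]) (hE₀ ω h) (hE₂ ω h')
  have hd12 : Disjoint E₁ E₂ := Set.disjoint_left.2 fun ω h h' =>
    hsep (by rw [sub_neg_eq_add, abs_of_pos (by positivity)]; linarith) (hE₁ ω h) (hE₂ ω h')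
  have h1 := measureReal_union (μ := P) hd12 hm₂
  have h2 := measureReal_union (μ := P) (hd01.union_right hd02) (hm₁.union hm₂)
  have h3 : P.real (E₀ ∪ (E₁ ∪ E₂)) ≤ 1 := measureReal_le_one
  linarith

/-! ### A finite family of test directions -/

/-- The test direction with parameters `g`: an integer vector with coordinates of the form
`c - 2 d`, written as a sum of `m` multiples of basis vectors. -/
noncomputable def testDirection {d m : ℕ} (g : Fin m → Fin d × Fin (4 * d + 1)) :
    EuclideanSpace ℝ (Fin d) :=
  ∑ j, EuclideanSpace.single (g j).1 ((((g j).2 : ℕ) : ℝ) - 2 * d)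

lemma exists_testDirection_eq_neg {d m : ℕ} (g : Fin m → Fin d × Fin (4 * d + 1)) :
    ∃ g' : Fin m → Fin d × Fin (4 * d + 1), testDirection g' = -testDirection g := by
  refine ⟨fun j => ((g j).1, (g j).2.rev), ?_⟩
  rw [testDirection, testDirection, ← Finset.sum_neg_distrib]
  refine Finset.sum_congr rfl fun j _ => ?_
  have h : (g j).2 + ((g j).2.rev : ℕ) = 4 * d := by
    rw [Fin.val_rev]; omega
  have h' : (((g j).2 : ℕ) : ℝ) + (((g j).2.rev : ℕ) : ℝ) = 4 * d := by exact_mod_cast h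
  rw [← PiLp.single_neg]
  congr 1
  linarith

lemma exists_testDirection_eq {d : ℕ} (i₀ : Fin d) (m : ℕ) (z : Fin d → ℤ)
    (hz : ∀ i, |z i| ≤ 2 * d) (hm : {i | z i ≠ 0}.ncard ≤ m) :
    ∃ g : Fin m → Fin d × Fin (4 * d + 1),
      testDirection g = WithLp.toLp 2 fun i => (z i : ℝ) := by
  induction m generalizing z with
  | zero =>
    have h : ∀ i, z i = 0 := by
      have := (Set.ncard_eq_zero (Set.toFinite _)).1 (Nat.le_zero.1 hm)
      intro i
      by_contra hi
      exact (Set.eq_empty_iff_forall_notMem.1 this i) hi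
    refine ⟨Fin.elim0, ?_⟩
    ext i
    simp [testDirection, h]
  | succ m ih =>
    obtain ⟨i, hi⟩ : ∃ i, {j | z j ≠ 0} \ {i} = {j | Function.update z i 0 j ≠ 0} ∧
        ({j | z j ≠ 0} \ {i}).ncard ≤ m := by
      by_cases hne : ∃ i, z i ≠ 0
      · obtain ⟨i, hi⟩ := hne
        refine ⟨i, ?_, ?_⟩
        · ext j
          by_cases hj : j = i <;> simp [hj, Function.update]
        · rw [Set.ncard_sdiff_singleton_of_mem (by exact hi)]
          omega
      · push Not at hne
        refine ⟨i₀, ?_, ?_⟩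
        · ext j
          by_cases hj : j = i₀ <;> simp [hj, hne, Function.update]
        · simp [hne]
    obtain ⟨g, hg⟩ := ih (Function.update z i 0) (fun j => by
      by_cases hj : j = i
      · subst hj; simp
      · simpa [hj] using hz j) (hi.1 ▸ hi.2)
    have hzi := abs_le.1 (hz i)
    have hlt : (z i + 2 * d).toNat < 4 * d + 1 := by omega
    refine ⟨Fin.cons (i, ⟨(z i + 2 * d).toNat, hlt⟩) g, ?_⟩
    have hcast : (((z i + 2 * d).toNat : ℕ) : ℝ) = z i + 2 * d := by
      have : (((z i + 2 * d).toNat : ℕ) : ℤ) = z i + 2 * d := Int.toNat_of_nonneg (by omega)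
      exact_mod_cast this
    rw [testDirection, Fin.sum_univ_succ]
    simp only [Fin.cons_zero, Fin.cons_succ]
    change _ + testDirection g = _
    rw [hg, hcast, add_sub_cancel_right]
    ext j
    by_cases hj : j = i
    · subst hj; simp
    · simp [hj]

/-- Some test direction makes a small angle with a given sparse vector: rescale the vector to norm
`2 d` and round its coordinates. -/
lemma exists_testDirection_inner {d m : ℕ} (w : EuclideanSpace ℝ (Fin d)) (hw : w ≠ 0)
    (hm : IsSparse m w) :
    ∃ g : Fin m → Fin d × Fin (4 * d + 1), testDirection g ≠ 0 ∧
      3 / 5 * ‖testDirection g‖ * ‖w‖ ≤ ⟪testDirection g, w⟫ := by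
  have hwn : 0 < ‖w‖ := norm_pos_iff.2 hw
  obtain ⟨i₀⟩ : Nonempty (Fin d) := by
    by_contra h
    rw [not_nonempty_iff] at h
    exact hw (Subsingleton.elim _ _)
  have hd : (1 : ℝ) ≤ d := by exact_mod_cast (Nat.succ_le_of_lt (Fin.pos i₀))
  set y : EuclideanSpace ℝ (Fin d) := (2 * d / ‖w‖) • w with hy
  have hyn : ‖y‖ = 2 * d := by
    rw [hy, norm_smul, Real.norm_of_nonneg (by positivity), div_mul_cancel₀ _ hwn.ne']
  have hyi : ∀ i, |y i| ≤ 2 * d := fun i => hyn ▸ PiLp.norm_apply_le y i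
  obtain ⟨g, hg⟩ := exists_testDirection_eq i₀ m (fun i => round (y i)) (by
      intro i
      obtain ⟨h1, h2⟩ := abs_le.1 (hyi i)
      obtain ⟨h3, h4⟩ := abs_le.1 (abs_sub_round (y i))
      rw [abs_le]
      constructor
      · have : (-(2 * d) - 1 : ℝ) < round (y i) := by linarith
        have : -(2 * d) - 1 < round (y i) := by exact_mod_cast this
        omega
      · have : (round (y i) : ℝ) < 2 * d + 1 := by linarith
        have : round (y i) < 2 * d + 1 := by exact_mod_cast this
        omega) (by
      refine le_trans (Set.ncard_le_ncard (fun i hi => ?_) (Set.toFinite _)) hm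
      intro h
      exact hi (by simp [hy, h]))
  set v : EuclideanSpace ℝ (Fin d) := testDirection g with hv
  have hdiff : ‖v - y‖ ≤ d / 2 := by
    refine abs_le_of_sq_le_sq' ?_ (by positivity) |>.2
    -- rounding moves each of the `d` coordinates by at most `1 / 2`, and `d / 4 ≤ (d / 2) ^ 2`
    rw [EuclideanSpace.real_norm_sq_eq]
    have : ∀ i, (v - y) i ^ 2 ≤ (1 / 2 : ℝ) ^ 2 := by
      intro i
      rw [hg]
      refine sq_le_sq' ?_ ?_ <;> simp only [PiLp.sub_apply] <;>
        linarith [abs_le.1 (abs_sub_round (y i))]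
    refine (Finset.sum_le_sum fun i _ => this i).trans ?_
    rw [Finset.sum_const, Finset.card_univ, Fintype.card_fin, nsmul_eq_mul]
    nlinarith
  have hinner : 3 / 2 * d * ‖w‖ ≤ ⟪v, w⟫ := by
    have h1 : ⟪v, w⟫ = ⟪y, w⟫ + ⟪v - y, w⟫ := by rw [← inner_add_left]; congr 1; abel
    have h2 : ⟪y, w⟫ = 2 * d * ‖w‖ := by
      rw [hy, real_inner_smul_left, real_inner_self_eq_norm_sq]; field_simp
    have h3 := (abs_le.1 (abs_real_inner_le_norm (v - y) w)).1
    have h4 := mul_le_mul_of_nonneg_right hdiff hwn.le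
    linarith
  have hvn : ‖v‖ ≤ 5 / 2 * d := by
    have := norm_add_le (v - y) y
    rw [sub_add_cancel] at this
    linarith
  refine ⟨g, ?_, ?_⟩
  · intro h
    rw [← hv] at h
    rw [h, inner_zero_left] at hinner
    have : 0 < 3 / 2 * d * ‖w‖ := by positivity
    linarith
  · have := mul_le_mul_of_nonneg_right hvn hwn.le
    linarith

/-! ### Centres of a sample -/

/-- The number of sample points lying more than `t ‖v‖` above `x` in direction `v`. -/
noncomputable def tailCount {d n : ℕ} (v x : EuclideanSpace ℝ (Fin d)) (t : ℝ)
    (Y : Fin n → EuclideanSpace ℝ (Fin d)) : ℕ :=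
  {i | t * ‖v‖ < ⟪v, Y i - x⟫}.ncard

/-- The point `x` is central if in no test direction half of the sample lies more than `t` (in
units of the length of the direction) above it: an approximate, sparse form of Tukey depth. -/
def IsCentral {d n : ℕ} (m : ℕ) (t : ℝ) (x : EuclideanSpace ℝ (Fin d))
    (Y : Fin n → EuclideanSpace ℝ (Fin d)) : Prop :=
  ∀ g : Fin m → Fin d × Fin (4 * d + 1), (tailCount (testDirection g) x t Y : ℝ) < n / 2

lemma IsCorruption.tailCount_le {d n : ℕ} {ε : ℝ} {X Y : Fin n → EuclideanSpace ℝ (Fin d)}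
    (h : IsCorruption ε X Y) (v x : EuclideanSpace ℝ (Fin d)) (t : ℝ) :
    (tailCount v x t Y : ℝ) ≤ tailCount v x t X + ε * n := by
  obtain ⟨σ, hσ⟩ := h
  have h1 : {i | t * ‖v‖ < ⟪v, Y i - x⟫} ⊆
      (σ ⁻¹' {i | t * ‖v‖ < ⟪v, X i - x⟫}) ∪ {i | Y i ≠ X (σ i)} := by
    intro i hi
    by_cases hYX : Y i = X (σ i)
    · left
      simpa [← hYX] using hi
    · exact Or.inr hYX
  have h2 := (Set.ncard_le_ncard h1 (Set.toFinite _)).trans (Set.ncard_union_le _ _)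
  rw [Set.ncard_preimage_of_injective_subset_range σ.injective (by simp)] at h2
  have h3 : (tailCount v x t Y : ℝ) ≤ tailCount v x t X + {i | Y i ≠ X (σ i)}.ncard := by
    exact_mod_cast h2
  linarith

lemma tailCount_le_of_norm_sub_le {d n : ℕ} {v x q : EuclideanSpace ℝ (Fin d)} {t : ℝ}
    (h : ‖q - x‖ ≤ t) (Y : Fin n → EuclideanSpace ℝ (Fin d)) :
    tailCount v q (2 * t) Y ≤ tailCount v x t Y := by
  refine Set.ncard_le_ncard (fun i hi => ?_) (Set.toFinite _)
  rw [Set.mem_ofPred_eq] at hi ⊢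
  have h1 : ⟪v, Y i - x⟫ = ⟪v, Y i - q⟫ + ⟪v, q - x⟫ := by rw [← inner_add_right]; congr 1; abel
  have h2 := (abs_le.1 (abs_real_inner_le_norm v (q - x))).1
  have h3 := mul_le_mul_of_nonneg_left h (norm_nonneg v)
  linarith

/-- Otherwise every sample point would be above `x` or below `q`. -/
lemma inner_sub_le_of_tailCount {d n : ℕ} {v x q : EuclideanSpace ℝ (Fin d)} {s t : ℝ}
    {Y : Fin n → EuclideanSpace ℝ (Fin d)} (hx : (tailCount v x s Y : ℝ) < n / 2)
    (hq : (tailCount (-v) q t Y : ℝ) < n / 2) : ⟪v, q - x⟫ ≤ (s + t) * ‖v‖ := by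
  by_contra! h
  have hcover : (Set.univ : Set (Fin n)) ⊆
      {i | s * ‖v‖ < ⟪v, Y i - x⟫} ∪ {i | t * ‖-v‖ < ⟪-v, Y i - q⟫} := by
    intro i _
    by_contra hi
    simp only [Set.mem_union, Set.mem_ofPred_eq, not_or, not_lt, norm_neg, inner_neg_left] at hi
    have h1 : ⟪v, Y i - x⟫ = ⟪v, Y i - q⟫ + ⟪v, q - x⟫ := by rw [← inner_add_right]; congr 1; abel
    linarith [hi.1, hi.2]
  have h1 := (Set.ncard_le_ncard hcover (Set.toFinite _)).trans (Set.ncard_union_le _ _)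
  rw [Set.ncard_univ, Nat.card_fin] at h1
  have h2 : (n : ℝ) ≤ tailCount v x s Y + tailCount (-v) q t Y := by exact_mod_cast h1
  linarith

lemma IsSparse.sub {d k : ℕ} {x y : EuclideanSpace ℝ (Fin d)} (hx : IsSparse k x)
    (hy : IsSparse k y) : IsSparse (2 * k) (x - y) := by
  have hsub : {i | (x - y) i ≠ 0} ⊆ {i | x i ≠ 0} ∪ {i | y i ≠ 0} := by
    intro i hi
    by_contra h
    simp only [Set.mem_union, Set.mem_ofPred_eq, not_or, not_not] at h
    exact hi (by simp [h.1, h.2])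
  have := (Set.ncard_le_ncard hsub (Set.toFinite _)).trans (Set.ncard_union_le _ _)
  unfold IsSparse at *
  omega

lemma IsCentral.norm_sub_le {d n k : ℕ} {s t : ℝ} (hst : 0 ≤ s + t)
    {x q : EuclideanSpace ℝ (Fin d)}
    {Y : Fin n → EuclideanSpace ℝ (Fin d)} (hxs : IsSparse k x) (hqs : IsSparse k q)
    (hx : IsCentral (2 * k) s x Y) (hq : IsCentral (2 * k) t q Y) :
    ‖q - x‖ ≤ 5 / 3 * (s + t) := by
  by_cases hw : q - x = 0
  · rw [hw, norm_zero]; positivity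
  obtain ⟨g, hg0, hg⟩ := exists_testDirection_inner _ hw (hqs.sub hxs)
  obtain ⟨g', hg'⟩ := exists_testDirection_eq_neg g
  have h := inner_sub_le_of_tailCount (hx g) (hg' ▸ hq g')
  have hpos := norm_pos_iff.2 hg0
  have h2 : 3 / 5 * ‖q - x‖ ≤ s + t := by
    refine le_of_mul_le_mul_right ?_ hpos
    linarith
  linarith

lemma measurable_tailCount {d n : ℕ} (v x : EuclideanSpace ℝ (Fin d)) (t : ℝ) :
    Measurable fun Y : Fin n → EuclideanSpace ℝ (Fin d) => (tailCount v x t Y : ℝ) := by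
  classical
  have h : (fun Y : Fin n → EuclideanSpace ℝ (Fin d) => (tailCount v x t Y : ℝ)) =
      fun Y => ∑ i,
        {y | t * ‖v‖ < ⟪v, y - x⟫}.indicator (1 : EuclideanSpace ℝ (Fin d) → ℝ) (Y i) := by
    ext Y
    have : {i | t * ‖v‖ < ⟪v, Y i - x⟫} = ((Finset.univ.filter fun i => t * ‖v‖ < ⟪v, Y i - x⟫ :
      Finset (Fin n)) : Set (Fin n)) := by ext; simp
    rw [tailCount, this, Set.ncard_coe_finset, Finset.card_filter]
    push_cast
    refine Finset.sum_congr rfl fun j _ => ?_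
    simp [Set.indicator_apply]
  rw [h]
  have hm : MeasurableSet {y : EuclideanSpace ℝ (Fin d) | t * ‖v‖ < ⟪v, y - x⟫} :=
    measurableSet_lt measurable_const (by fun_prop)
  exact Finset.measurable_sum _ fun i _ =>
    (measurable_one.indicator hm).comp (measurable_pi_apply i)

lemma measurableSet_isCentral {d n : ℕ} (m : ℕ) (t : ℝ) (x : EuclideanSpace ℝ (Fin d)) :
    MeasurableSet {Y : Fin n → EuclideanSpace ℝ (Fin d) | IsCentral m t x Y} := by
  have : {Y : Fin n → EuclideanSpace ℝ (Fin d) | IsCentral m t x Y} =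
      ⋂ g : Fin m → Fin d × Fin (4 * d + 1),
        {Y | (tailCount (testDirection g) x t Y : ℝ) < n / 2} := by
    ext Y; simp [IsCentral]
  rw [this]
  exact .iInter fun g => measurableSet_lt (measurable_tailCount _ _ _) measurable_const

/-- Measurable selection of a sparse central point: take the first one in a dense sequence. -/
lemma exists_measurable_central {d n : ℕ} (k m : ℕ) {t : ℝ} (ht : 0 < t) :
    ∃ T : (Fin n → EuclideanSpace ℝ (Fin d)) → EuclideanSpace ℝ (Fin d), Measurable T ∧
      (∀ Y, IsSparse k (T Y)) ∧
      ∀ Y, (∃ x, IsSparse k x ∧ IsCentral m t x Y) → IsCentral m (2 * t) (T Y) Y := by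
  classical
  have : Nonempty {x : EuclideanSpace ℝ (Fin d) // IsSparse k x} := ⟨⟨0, by simp [IsSparse]⟩⟩
  set q := TopologicalSpace.denseSeq {x : EuclideanSpace ℝ (Fin d) // IsSparse k x}
  -- the second alternative makes the search succeed for every sample
  set p : ℕ → (Fin n → EuclideanSpace ℝ (Fin d)) → Prop := fun j Y =>
    IsCentral m (2 * t) (q j).1 Y ∨ ∀ i, ¬ IsCentral m (2 * t) (q i).1 Y with hp
  have hex : ∀ Y, ∃ j, p j Y := by
    intro Y
    by_cases h : ∃ j, IsCentral m (2 * t) (q j).1 Y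
    · exact h.imp fun j hj => Or.inl hj
    · exact ⟨0, Or.inr (not_exists.1 h)⟩
  have hpm : ∀ j, MeasurableSet {Y | p j Y} := by
    intro j
    have h : {Y | p j Y} = {Y | IsCentral m (2 * t) (q j).1 Y} ∪
        ⋂ i, {Y | IsCentral m (2 * t) (q i).1 Y}ᶜ := by ext; simp [hp]
    rw [h]
    exact (measurableSet_isCentral m _ _).union
      (.iInter fun i => (measurableSet_isCentral m _ _).compl)
  refine ⟨fun Y => (q (Nat.find (hex Y))).1,
    Measurable.find (f := fun j _ => (q j).1) (fun j => measurable_const) hpm hex,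
    fun Y => (q _).2, ?_⟩
  rintro Y ⟨x, hxs, hx⟩
  obtain ⟨j, hj⟩ := (TopologicalSpace.denseRange_denseSeq _).exists_dist_lt
    (⟨x, hxs⟩ : {x : EuclideanSpace ℝ (Fin d) // IsSparse k x}) ht
  have hqj : IsCentral m (2 * t) (q j).1 Y := by
    intro g
    have h1 : ‖(q j).1 - x‖ ≤ t := by
      rw [norm_sub_rev, ← dist_eq_norm]; exact hj.le
    have h2 : (tailCount (testDirection g) (q j).1 (2 * t) Y : ℝ) ≤
        tailCount (testDirection g) x t Y := by
      exact_mod_cast tailCount_le_of_norm_sub_le h1 Y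
    exact h2.trans_lt (hx g)
  exact (Nat.find_spec (hex Y)).resolve_right fun h => h j hqj

/-! ### Gaussian tails -/

lemma gaussianReal_real_Ioi_zero : (gaussianReal 0 1).real (Set.Ioi 0) = 1 / 2 := by
  have hsymm : (gaussianReal 0 1).real (Set.Iic 0) = (gaussianReal 0 1).real (Set.Ioi 0) := by
    have h1 : (gaussianReal 0 1).map (fun x => -x) = gaussianReal 0 1 := by
      rw [gaussianReal_map_neg, neg_zero]
    have : NullSingletonClass (gaussianReal 0 1) := nullSingletonClass_gaussianReal one_ne_zero
    rw [measureReal_def, measureReal_def, ← Iio_ae_eq_Iic.measure_eq]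
    conv_lhs => rw [← h1]
    rw [Measure.map_apply (by fun_prop) measurableSet_Iio]
    simp
  have h2 := probReal_compl_eq_one_sub (μ := gaussianReal 0 1) (measurableSet_Ioi (a := (0 : ℝ)))
  rw [Set.compl_Ioi, hsymm] at h2
  linarith

/-- The density of `N(0, 1)` decreases on the positive axis, so the mass of `(0, t]` is concave. -/
lemma mul_gaussianReal_Ioc_le {a t : ℝ} (ha0 : 0 ≤ a) (ha1 : a ≤ 1) (ht : 0 ≤ t) :
    a * (gaussianReal 0 1).real (Set.Ioc 0 t) ≤ (gaussianReal 0 1).real (Set.Ioc 0 (a * t)) := by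
  have h : ∀ s : ℝ, 0 ≤ s →
      (gaussianReal 0 1).real (Set.Ioc 0 s) = ∫ x in (0 : ℝ)..s, gaussianPDFReal 0 1 x := by
    intro s hs
    rw [measureReal_def, gaussianReal_apply_eq_integral 0 one_ne_zero,
      intervalIntegral.integral_of_le hs, ENNReal.toReal_ofReal
        (integral_nonneg fun x => gaussianPDFReal_nonneg 0 1 x)]
  have hcont : Continuous (gaussianPDFReal 0 1) := by
    rw [gaussianPDFReal_def]; fun_prop
  rw [h t ht, h (a * t) (by positivity)]
  have hsub := intervalIntegral.mul_integral_comp_mul_left (f := gaussianPDFReal 0 1)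
    (a := 0) (b := t) (c := a)
  rw [mul_zero] at hsub
  rw [← hsub]
  refine mul_le_mul_of_nonneg_left ?_ ha0
  refine intervalIntegral.integral_mono_on ht (hcont.intervalIntegrable _ _)
    ((hcont.comp (continuous_const.mul continuous_id)).intervalIntegrable _ _) fun x hx => ?_
  rw [gaussianPDFReal, gaussianPDFReal]
  have : (a * x) ^ 2 ≤ x ^ 2 := by
    rw [mul_pow]; exact mul_le_of_le_one_left (sq_nonneg x) (pow_le_one₀ ha0 ha1)
  refine mul_le_mul_of_nonneg_left (Real.exp_le_exp.2 ?_) (by positivity)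
  rw [sub_zero, sub_zero, NNReal.coe_one, mul_one]
  linarith

/-- The tail of `N(0, 1)` beyond a multiple of `ε` leaves room below `1 / 2` for a fraction `ε` of
corrupted points and for a fluctuation proportional to `ε`. -/
lemma exists_gaussianReal_Ioi_le {ε₀ : ℝ} (h0 : 0 < ε₀) (h1 : ε₀ < 1 / 2) :
    ∃ t a : ℝ, 0 < t ∧ 0 < a ∧ ∀ ε, 0 < ε → ε ≤ ε₀ →
      (gaussianReal 0 1).real (Set.Ioi (t * ε)) ≤ 1 / 2 - ε - a * ε := by
  have hIoi : ∀ s : ℝ, (gaussianReal 0 1).real (Set.Ioi s) = 1 - cdf (gaussianReal 0 1) s := by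
    intro s
    rw [cdf_eq_real, ← probReal_compl_eq_one_sub measurableSet_Iic, Set.compl_Iic]
  -- `1 / 4 + ε₀ / 2` is the midpoint of `ε₀` and `1 / 2`: the bound is proved at `ε₀` with this
  -- slack, and extended to smaller `ε` by concavity
  obtain ⟨s, hs0, hs⟩ : ∃ s : ℝ, 0 < s ∧
      (gaussianReal 0 1).real (Set.Ioi s) < 1 / 2 - (1 / 4 + ε₀ / 2) := by
    have hlim := tendsto_cdf_atTop (gaussianReal 0 1)
    have hev := hlim.eventually (lt_mem_nhds (show 1 / 2 + (1 / 4 + ε₀ / 2) < 1 by linarith))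
    obtain ⟨s, hs, hs0⟩ := (hev.and (Filter.eventually_gt_atTop 0)).exists
    exact ⟨s, hs0, by rw [hIoi]; linarith⟩
  have hsplit : ∀ s : ℝ, 0 ≤ s → (gaussianReal 0 1).real (Set.Ioi s) =
      1 / 2 - (gaussianReal 0 1).real (Set.Ioc 0 s) := by
    intro s hs
    have h2 := measureReal_union (μ := gaussianReal 0 1) (Set.Ioc_disjoint_Ioi (a := 0) (le_refl s))
      measurableSet_Ioi
    rw [Set.Ioc_union_Ioi_eq_Ioi hs, gaussianReal_real_Ioi_zero] at h2
    linarith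
  refine ⟨s / ε₀, (1 / 2 - ε₀) / (2 * ε₀), by positivity,
    div_pos (by linarith) (by linarith), fun ε hε hεε => ?_⟩
  have hconc := mul_gaussianReal_Ioc_le (a := ε / ε₀) (by positivity)
    (div_le_one_of_le₀ hεε h0.le) hs0.le
  rw [hsplit s hs0.le] at hs
  rw [show s / ε₀ * ε = ε / ε₀ * s by ring, hsplit _ (by positivity)]
  have h3 : ε / ε₀ * (1 / 4 + ε₀ / 2) ≤ ε / ε₀ * (gaussianReal 0 1).real (Set.Ioc 0 s) :=
    mul_le_mul_of_nonneg_left (by linarith) (by positivity)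
  have h4 : ε / ε₀ * (1 / 4 + ε₀ / 2) = ε + (1 / 2 - ε₀) / (2 * ε₀) * ε := by
    field_simp; ring
  linarith

lemma multivariateGaussian_inner_gt_le {d : ℕ} (μ v : EuclideanSpace ℝ (Fin d)) (t : ℝ) :
    (multivariateGaussian μ (1 : Matrix (Fin d) (Fin d) ℝ)).real
      {y | t * ‖v‖ < ⟪v, y - μ⟫} ≤ (gaussianReal 0 1).real (Set.Ioi t) := by
  set P := multivariateGaussian μ (1 : Matrix (Fin d) (Fin d) ℝ)
  have hmean : ∫ y, innerSL ℝ v y ∂P = ⟪v, μ⟫ := by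
    rw [(innerSL ℝ v).integral_comp_id_comm IsGaussian.integrable_id]
    simp [P]
  have hvar : Var[innerSL ℝ v; P] = ‖v‖ ^ 2 := by
    have h1 := covarianceBilin_self (μ := P) IsGaussian.memLp_two_id v
    rw [covarianceBilin_multivariateGaussian Matrix.PosSemidef.one, Matrix.one_mulVec] at h1
    change Var[fun y => ⟪v, y⟫; P] = _
    rw [← h1, EuclideanSpace.real_norm_sq_eq]
    simp [dotProduct, pow_two]
  have hmap : P.map (innerSL ℝ v) = (gaussianReal 0 1).map fun z => ‖v‖ * z + ⟪v, μ⟫ := by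
    rw [IsGaussian.map_eq_gaussianReal, hmean, hvar]
    have h2 : (fun z => ‖v‖ * z + ⟪v, μ⟫) = (fun z => z + ⟪v, μ⟫) ∘ (fun z => ‖v‖ * z) := rfl
    rw [h2, ← Measure.map_map (by fun_prop) (by fun_prop), gaussianReal_map_const_mul,
      gaussianReal_map_add_const]
    congr 1
    · simp
    · ext; simp
  have hset : {y | t * ‖v‖ < ⟪v, y - μ⟫} = innerSL ℝ v ⁻¹' Set.Ioi (t * ‖v‖ + ⟪v, μ⟫) := by
    ext y
    simp [inner_sub_right, lt_sub_iff_add_lt]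
  rw [hset, ← map_measureReal_apply (by fun_prop) measurableSet_Ioi, hmap,
    map_measureReal_apply (by fun_prop) measurableSet_Ioi]
  refine measureReal_mono fun z hz => ?_
  simp only [Set.mem_preimage, Set.mem_Ioi, add_lt_add_iff_right] at hz ⊢
  rw [mul_comm] at hz
  exact lt_of_mul_lt_mul_left hz (norm_nonneg v)

/-! ### Upper bound -/

/-- Hoeffding's inequality for the number of sample points in a set. -/
lemma pi_real_count_ge_le {E : Type*} [MeasurableSpace E] (P : Measure E) [IsProbabilityMeasure P]
    (n : ℕ) {S : Set E} (hS : MeasurableSet S) {q η : ℝ} (hq : P.real S ≤ q) (hη : 0 ≤ η) :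
    (Measure.pi fun _ : Fin n => P).real {X | (q + η) * n ≤ ({i | X i ∈ S}.ncard : ℝ)} ≤
      Real.exp (-(2 * η ^ 2 * n)) := by
  classical
  set f : E → ℝ := fun x => S.indicator 1 x - P.real S with hf
  have hind : Measurable (S.indicator (1 : E → ℝ)) := measurable_one.indicator hS
  have hfm : Measurable f := hind.sub_const _
  have hsub : HasSubgaussianMGF f ((‖(1 : ℝ) - 0‖₊ / 2) ^ 2) P := by
    have h := hasSubgaussianMGF_of_mem_Icc (μ := P) (X := S.indicator 1) (a := 0) (b := 1)
      hind.aemeasurable (.of_forall fun x => ⟨Set.indicator_nonneg (by simp) x,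
        Set.indicator_le_self' (by simp) x |>.trans (by simp)⟩)
    rwa [integral_indicator_one hS] at h
  have hsubi : ∀ i : Fin n, HasSubgaussianMGF (fun X : Fin n → E => f (X i))
      ((‖(1 : ℝ) - 0‖₊ / 2) ^ 2) (Measure.pi fun _ : Fin n => P) := by
    intro i
    have hmp := measurePreserving_eval (fun _ : Fin n => P) i
    exact HasSubgaussianMGF.of_map (Y := fun X : Fin n → E => X i) (X := f)
      hmp.measurable.aemeasurable (by rw [hmp.map_eq]; exact hsub)
  have hH := HasSubgaussianMGF.measure_sum_ge_le_of_iIndepFun (s := Finset.univ)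
    (iIndepFun_pi (μ := fun _ : Fin n => P) (X := fun _ => f) fun _ => hfm.aemeasurable)
    (fun i _ => hsubi i) (ε := η * n) (by positivity)
  refine (measureReal_mono (fun X hX => ?_)).trans (hH.trans ?_)
  · rw [Set.mem_ofPred_eq] at hX ⊢
    have hc : ({i | X i ∈ S}.ncard : ℝ) = ∑ i, S.indicator (1 : E → ℝ) (X i) := by
      have : {i | X i ∈ S} = ((Finset.univ.filter fun i => X i ∈ S : Finset (Fin n)) :
        Set (Fin n)) := by ext; simp
      rw [this, Set.ncard_coe_finset, Finset.card_filter]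
      push_cast
      refine Finset.sum_congr rfl fun j _ => ?_
      simp [Set.indicator_apply]
    rw [hf, Finset.sum_sub_distrib, ← hc, Finset.sum_const, Finset.card_univ, Fintype.card_fin,
      nsmul_eq_mul]
    have := mul_le_mul_of_nonneg_left hq n.cast_nonneg
    linarith
  · rw [Real.exp_le_exp, Finset.sum_const, Finset.card_univ, Fintype.card_fin, nsmul_eq_mul]
    rcases Nat.eq_zero_or_pos n with rfl | hn
    · simp
    · have hn' : (0 : ℝ) < n := by exact_mod_cast hn
      push_cast
      rw [sub_zero, norm_one]
      refine le_of_eq ?_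
      field_simp

lemma measurableSet_inner_gt {d : ℕ} (v x : EuclideanSpace ℝ (Fin d)) (t : ℝ) :
    MeasurableSet {y : EuclideanSpace ℝ (Fin d) | t < ⟪v, y - x⟫} :=
  measurableSet_lt measurable_const (by fun_prop)

/-- Union bound over the test directions. -/
lemma sampleLaw_not_isCentral_le {d n m : ℕ} {ε η s : ℝ} (hη : 0 ≤ η)
    (hs : (gaussianReal 0 1).real (Set.Ioi s) ≤ 1 / 2 - ε - η) (μ : EuclideanSpace ℝ (Fin d)) :
    (sampleLaw n μ).real {X | ∃ Y, IsCorruption ε X Y ∧ ¬ IsCentral m s μ Y} ≤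
      (d * (4 * d + 1)) ^ m * Real.exp (-(2 * η ^ 2 * n)) := by
  set A : (Fin m → Fin d × Fin (4 * d + 1)) → Set (Fin n → EuclideanSpace ℝ (Fin d)) := fun g =>
    {X | (1 / 2 - ε - η + η) * n ≤ (tailCount (testDirection g) μ s X : ℝ)} with hA
  have hsub : {X | ∃ Y, IsCorruption ε X Y ∧ ¬ IsCentral m s μ Y} ⊆ ⋃ g, A g := by
    rintro X ⟨Y, hXY, hY⟩
    rw [IsCentral, not_forall] at hY
    obtain ⟨g, hg⟩ := hY
    refine Set.mem_iUnion.2 ⟨g, ?_⟩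
    have := hXY.tailCount_le (testDirection g) μ s
    rw [hA, Set.mem_ofPred_eq]
    linarith
  have hg : ∀ g, (sampleLaw n μ).real (A g) ≤ Real.exp (-(2 * η ^ 2 * n)) := fun g =>
    pi_real_count_ge_le _ n (measurableSet_inner_gt (testDirection g) μ _)
      ((multivariateGaussian_inner_gt_le μ (testDirection g) s).trans hs) hη
  calc (sampleLaw n μ).real {X | ∃ Y, IsCorruption ε X Y ∧ ¬ IsCentral m s μ Y}
      ≤ (sampleLaw n μ).real (⋃ g, A g) := measureReal_mono hsub
    _ ≤ ∑ g, (sampleLaw n μ).real (A g) := measureReal_iUnion_fintype_le A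
    _ ≤ ∑ _g : Fin m → Fin d × Fin (4 * d + 1), Real.exp (-(2 * η ^ 2 * n)) :=
        Finset.sum_le_sum fun g _ => hg g
    _ = _ := by
        rw [Finset.sum_const, Finset.card_univ, nsmul_eq_mul]
        simp

/-- The number of test directions is at most `(d / ε) ^ (6 k)`. -/
lemma card_testDirection_mul_exp_le {d k n : ℕ} {ε δ a : ℝ} (hd : 1 ≤ d) (hε : 0 < ε)
    (hε1 : ε ≤ 1 / 2) (hδ : 0 < δ) (hδ1 : δ < 1)
    (h : 3 * (k * Real.log (d / ε) + Real.log (1 / δ)) ≤ (a * ε) ^ 2 * n) :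
    ((d : ℝ) * (4 * d + 1)) ^ (2 * k) * Real.exp (-(2 * (a * ε) ^ 2 * n)) ≤ δ := by
  have hd' : (1 : ℝ) ≤ d := by exact_mod_cast hd
  have hx : 2 * (d : ℝ) ≤ d / ε := by
    rw [le_div_iff₀ hε]; nlinarith
  have h1 : (d : ℝ) * (4 * d + 1) ≤ (d / ε) ^ 3 :=
    calc (d : ℝ) * (4 * d + 1) ≤ (2 * d) ^ 3 := by nlinarith [mul_self_nonneg (d : ℝ)]
      _ ≤ (d / ε) ^ 3 := by gcongr
  have h2 : ((d : ℝ) * (4 * d + 1)) ^ (2 * k) ≤ Real.exp (6 * (k * Real.log (d / ε))) := by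
    refine (pow_le_pow_left₀ (by positivity) h1 _).trans (le_of_eq ?_)
    rw [← pow_mul, ← Real.rpow_natCast, Real.rpow_def_of_pos (by positivity)]
    congr 1
    push_cast
    ring
  have h3 : 0 ≤ Real.log (1 / δ) := Real.log_nonneg (by rw [le_div_iff₀ hδ]; linarith)
  calc ((d : ℝ) * (4 * d + 1)) ^ (2 * k) * Real.exp (-(2 * (a * ε) ^ 2 * n))
      ≤ Real.exp (6 * (k * Real.log (d / ε))) * Real.exp (-(2 * (a * ε) ^ 2 * n)) := by gcongr
    _ = Real.exp (6 * (k * Real.log (d / ε)) + -(2 * (a * ε) ^ 2 * n)) := (Real.exp_add _ _).symm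
    _ ≤ Real.exp (Real.log δ) := by
        rw [Real.exp_le_exp]
        rw [one_div, Real.log_inv] at h3 h
        linarith
    _ = δ := Real.exp_log hδ

theorem exists_robust_estimator (ε₀ : ℝ) (h0 : 0 < ε₀) (h1 : ε₀ < 1 / 2) : ∃ C : ℝ, 0 < C ∧
      ∀ (d k n : ℕ) (ε δ : ℝ), 0 < ε → ε ≤ ε₀ → 0 < δ → δ < 1 →
        C * ((k * Real.log (d / ε) + Real.log (1 / δ)) / ε ^ 2) ≤ n →
        ∃ T : (Fin n → EuclideanSpace ℝ (Fin d)) → EuclideanSpace ℝ (Fin d),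
          Measurable T ∧ Recovers k ε (C * ε) δ T := by
  obtain ⟨t, a, ht, ha, htail⟩ := exists_gaussianReal_Ioi_le h0 h1
  refine ⟨5 * t + 3 / a ^ 2, by positivity, fun d k n ε δ hε hεε hδ hδ1 hn => ?_⟩
  -- for `d = 0` the logarithm `log (d / ε)` is `0`, and so is every mean
  rcases Nat.eq_zero_or_pos d with rfl | hd
  · refine ⟨fun _ => 0, measurable_const, fun μ _ => ?_⟩
    have hμ : μ = 0 := Subsingleton.elim _ _
    have hC : 0 ≤ (5 * t + 3 / a ^ 2) * ε := by positivity
    simp [hμ, not_lt.2 hC]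
  have hd' : (1 : ℝ) ≤ d := by exact_mod_cast hd
  obtain ⟨T, hTm, hTs, hT⟩ := exists_measurable_central (d := d) (n := n) k (2 * k)
    (t := t * ε) (by positivity)
  refine ⟨T, hTm, fun μ hμ => ?_⟩
  have hsub : {X | ∃ Y, IsCorruption ε X Y ∧ (5 * t + 3 / a ^ 2) * ε < ‖μ - T Y‖} ⊆
      {X | ∃ Y, IsCorruption ε X Y ∧ ¬ IsCentral (2 * k) (t * ε) μ Y} := by
    rintro X ⟨Y, hXY, hY⟩
    refine ⟨Y, hXY, fun hc => ?_⟩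
    have h2 := hc.norm_sub_le (by positivity) hμ (hTs Y) (hT Y ⟨μ, hμ, hc⟩)
    rw [norm_sub_rev] at h2
    have h3 : 0 ≤ 3 / a ^ 2 * ε := by positivity
    linarith
  have hbound : 3 * (k * Real.log (d / ε) + Real.log (1 / δ)) ≤ (a * ε) ^ 2 * n := by
    have h2 : 0 ≤ (k * Real.log (d / ε) + Real.log (1 / δ)) / ε ^ 2 := by
      have h3 : 0 ≤ Real.log (d / ε) := Real.log_nonneg (by rw [le_div_iff₀ hε]; linarith)
      have h4 : 0 ≤ Real.log (1 / δ) := Real.log_nonneg (by rw [le_div_iff₀ hδ]; linarith)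
      positivity
    have h3 : 3 / a ^ 2 * ((k * Real.log (d / ε) + Real.log (1 / δ)) / ε ^ 2) ≤ n := by
      refine le_trans (mul_le_mul_of_nonneg_right ?_ h2) hn
      linarith
    rw [div_mul_div_comm, div_le_iff₀ (by positivity)] at h3
    linarith
  refine (measure_mono hsub).trans ?_
  rw [← ofReal_measureReal]
  refine ENNReal.ofReal_le_ofReal ?_
  exact (sampleLaw_not_isCentral_le (by positivity) (htail ε hε hεε) μ).trans
    (card_testDirection_mul_exp_le hd hε (by linarith) hδ hδ1 hbound)

end RobustSparse

theorem mainTheorem10 :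
    -- upper bound: sample size `O((k log (d/ε) + log (1/δ)) / ε²)` suffices for error `O(ε)`
    (∀ ε₀ : ℝ, 0 < ε₀ → ε₀ < 1 / 2 → ∃ C : ℝ, 0 < C ∧
      ∀ (d k n : ℕ) (ε δ : ℝ), 0 < ε → ε ≤ ε₀ → 0 < δ → δ < 1 →
        C * ((k * Real.log (d / ε) + Real.log (1 / δ)) / ε ^ 2) ≤ n →
        ∃ T : (Fin n → EuclideanSpace ℝ (Fin d)) → EuclideanSpace ℝ (Fin d),
          Measurable T ∧ RobustSparse.Recovers k ε (C * ε) δ T) ∧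
    -- optimality of the error: with any number of samples, error `o(ε)` is impossible
    (∃ c : ℝ, 0 < c ∧
      ∀ (d k n : ℕ) (ε δ : ℝ), 1 ≤ d → 1 ≤ k → 0 < ε → δ < 1 / 2 →
        ∀ T : (Fin n → EuclideanSpace ℝ (Fin d)) → EuclideanSpace ℝ (Fin d),
          ¬ RobustSparse.Recovers k ε (c * ε) δ T) ∧
    -- optimality of the sample size up to logarithmic factors, even without corruption
    (∀ K : ℝ, 0 < K → ∃ c : ℝ, 0 < c ∧
      ∀ (d k n : ℕ) (ε δ : ℝ), 1 ≤ k → k ≤ d → 0 < ε → 0 < δ → δ ≤ 1 / 2 →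
        ∀ T : (Fin n → EuclideanSpace ℝ (Fin d)) → EuclideanSpace ℝ (Fin d),
          RobustSparse.Recovers k 0 (K * ε) δ T →
          c * ((k + Real.log (1 / δ)) / ε ^ 2) ≤ n) :=
  ⟨RobustSparse.exists_robust_estimator, RobustSparse.error_lower_bound,
    RobustSparse.sample_size_lower_bound⟩
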